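/- **Theorem 5.1.** A *tree* is a partially ordered set $(\Upsilon,\preccurlyeq)$ such that for every $t\in\Upsilon$ the set $(0,t]=\{s\in\Upsilon: s\preccurlyeq t\}$ is well-ordered; put $(0,t)=(0,t]\setminus\{t\}$ and $[t,\infty)=\{u\in\Upsilon:t\preccurlyeq u\}$. The tree is *Hausdorff* if $(0,t')=(0,t)$ implies $t'=t$ whenever the order type of $(0,t)$ is a (nonzero) limit ordinal. Give a Hausdorff tree $\Upsilon$ the coarsest topology for which all the sets $(0,t]$ are open and closed (it is locally compact and Hausdorff), and let $C_0(\Upsilon)$ be the Banach space, under the supremum norm, of continuous functions $f:\Upsilon\to\mathbb R$ such that $\{t:|f(t)|\ge\varepsilon\}$ is compact for every $\varepsilon>0$. Write $t^+$ for the set of immediate successors of $t$. A set $\Gamma\subseteq\Upsilon$ is *ever-branching* if for every $t\in\Gamma$ the set $\Gamma\cap[t,\infty)$ is not totally ordered. Let $\rho:\Upsilon\to\mathbb R$ be increasing, i.e. $s\preccurlyeq t$ implies $\rho(s)\le\rho(t)$. A point $t\in\Upsilon$ is *good* for $\rho$ if there is a finite $F\subseteq t^+$ with $\inf_{u\in t^+\setminus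 F}\rho(u)>\rho(t)$ (where $\inf\emptyset=+\infty$), and *bad* for $\rho$ otherwise. A norm $\|\cdot\|$ is *strictly convex* if $\|x\|=\|y\|=\tfrac12\|x+y\|$ implies $x=y$. It is *midpoint locally uniformly convex (MLUR)* if, for every $x$ and every sequence $(h_n)$, $\|x+h_n\|^2+\|x-h_n\|^2-2\|x\|^2\to0$ implies $\|h_n\|\to0$. Then, for every Hausdorff tree $\Upsilon$, the following are equivalent: 1. $C_0(\Upsilon)$ admits an equivalent strictly convex norm; 2. $C_0(\Upsilon)$ admits an equivalent MLUR norm; 3. there is an increasing function $\rho:\Upsilon\to\mathbb R$ such that (i) $\rho$ is constant on no non-empty ever-branching subset of $\Upsilon$, and (ii) for every $s\in\Upsilon$ there is at most one bad point $u$ for $\rho$ with $s\preccurlyeq u$ and $\rho(u)=\rho(s)$; 4. there is a bounded linear injection from $C_0(\Upsilon)$ into $c_0(I)$ for some set $I$. -/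

import Mathlib

open Set Filter Topology
open scoped ZeroAtInfty

universe u

namespace TreeRenorming

section Trees

/-- A tree: a partially ordered set in which every set `(0, t] = {s | s ≤ t}` is well-ordered. -/
class IsTree (Υ : Type*) [PartialOrder Υ] : Prop where
  isWellOrder_Iic : ∀ t : Υ, IsWellOrder (Iic t) (· < ·)

/-- A Hausdorff tree: if the order type of `(0, t)` is a limit ordinal and `(0, t') = (0, t)`, then
`t' = t`. In a tree the order type of `(0, t)` is a (nonzero) limit ordinal exactly when `t` is not
minimal and has no immediate predecessor, which is `Order.IsSuccLimit t`. -/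
class IsHausdorffTree (Υ : Type*) [PartialOrder Υ] : Prop extends IsTree Υ where
  eq_of_Iio_eq : ∀ t t' : Υ, Order.IsSuccLimit t → Iio t' = Iio t → t' = t

/-- The topology of `Υ` is the tree topology, the coarsest one for which all the
intervals `(0, t] = {s | s ≤ t}` are both open and closed. -/
class IsTreeTopology (Υ : Type*) [PartialOrder Υ] [τ : TopologicalSpace Υ] : Prop where
  eq_generateFrom :
    τ = TopologicalSpace.generateFrom {U : Set Υ | ∃ t : Υ, U = Iic t ∨ U = (Iic t)ᶜ}

variable {Υ : Type*} [PartialOrder Υ]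

/-- The set `t⁺` of immediate successors of `t`. -/
def immSucc (t : Υ) : Set Υ := {u | t ⋖ u}

/-- `Γ` is ever-branching if, for every `t ∈ Γ`, the set `Γ ∩ [t, ∞)` is not totally ordered. -/
def IsEverBranching (Γ : Set Υ) : Prop :=
  ∀ t ∈ Γ, ¬ IsChain (· ≤ ·) (Γ ∩ Ici t)

/-- `t` is a good point for `ρ` if `inf {ρ u | u ∈ t⁺ \ F} > ρ t` for some finite `F ⊆ t⁺`
(with the usual convention that the infimum over the empty set is `+∞`). -/
def IsGoodPoint (ρ : Υ → ℝ) (t : Υ) : Prop :=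
  ∃ F : Set Υ, F.Finite ∧ F ⊆ immSucc t ∧
    ∃ δ : ℝ, 0 < δ ∧ ∀ u ∈ immSucc t \ F, ρ t + δ ≤ ρ u

/-- A bad point for `ρ` is a point that is not good. -/
def IsBadPoint (ρ : Υ → ℝ) (t : Υ) : Prop := ¬ IsGoodPoint ρ t

end Trees

section Norms

variable {X : Type*} [NormedAddCommGroup X] [NormedSpace ℝ X]

/-- `p` is a norm on `X` that is equivalent to the given norm. (The lower bound makes the
seminorm `p` a norm.) -/
def IsEquivalentNorm (p : Seminorm ℝ X) : Prop :=
  ∃ c C : ℝ, 0 < c ∧ 0 < C ∧ ∀ x : X, c * ‖x‖ ≤ p x ∧ p x ≤ C * ‖x‖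

/-- Strict convexity: `p x = p y = p (x + y) / 2` implies `x = y`. -/
def IsStrictlyConvexNorm (p : Seminorm ℝ X) : Prop :=
  ∀ x y : X, p x = p y → p y = 1 / 2 * p (x + y) → x = y

/-- Midpoint local uniform convexity (MLUR): for every `x` and every sequence `h`, if
`p (x + h n) ^ 2 + p (x - h n) ^ 2 - 2 * p x ^ 2` tends to `0`, then `h` tends to `0` in norm. -/
def IsMLURNorm (p : Seminorm ℝ X) : Prop :=
  ∀ (x : X) (h : ℕ → X),
    Tendsto (fun n => p (x + h n) ^ 2 + p (x - h n) ^ 2 - 2 * p x ^ 2) atTop (𝓝 0) →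
      Tendsto (fun n => p (h n)) atTop (𝓝 0)

end Norms

end TreeRenorming

/-! A strictly convex norm `p` yields the potential `headInf p`: at `t`, the infimum of `p` over
functions equal to 1 on (0,t] and vanishing off (0,t] ∪ [t,∞). If this were constant on an
ever-branching set, a contraction argument would produce minimisers, each the mean of two different
minimisers (`exists_attaining_of_branching`). At a bad point u, averaging near-minimisers from many
successors shows that the indicator of (0,u] is itself a minimiser (`le_headInf_of_isBadPoint`), so
two bad points on one level above s would give two minimisers at s. Strict convexity excludes both.

Conversely, ρ may be made left continuous at limits (`leftLimit`). A function f then gets two kinds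
of coordinates: its value at each root, where ρ jumps, and at each good point its drop, the part of
f(s) not passed on to successors of the same level. Every jump of ρ encloses a rational, and
rationals along a branch do not repeat, so weights indexed by them send these coordinates into c₀
(`exists_coord_operator`).

Active coordinates determine key points: the predecessor of an active root, an active node itself,
and the bad point of the level component of either. By `IsRegularPotential.value_cases`, f(w) equals
f at the infimum of the key points above w, or is zero when there are none, unless w is a limit of
active roots. Hence no nonzero f has all coordinates zero, and the operator is injective. An
injection into c₀ gives a strictly convex norm by Day's method.

For MLUR, compactness makes this quantitative: for every large finite set A of active coordinates
and every t, f(t) is within ε of f(a) or of f(b), where a is the infimum of the key points above t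
and b the last root of A below t. So (f(t) - f(a))(f(t) - f(b)) is uniformly small. A Day-type norm
involves suprema of sums of squares in which, after completing a square, t enters only through this
product. For a suitable A all t then nearly attain the supremum at once, so an almost flat
perturbation h is small on all test functionals simultaneously, which bounds |h(t)| uniformly. -/

namespace TreeRenorming

/-! ### Order structure of trees -/

section TreeOrder

variable {Υ : Type*} [PartialOrder Υ]

theorem le_or_le_of_le [IsTree Υ] {x y t : Υ} (hx : x ≤ t) (hy : y ≤ t) : x ≤ y ∨ y ≤ x := by
  have := IsTree.isWellOrder_Iic t
  rcases trichotomous_of (· < ·) (⟨x, hx⟩ : Iic t) ⟨y, hy⟩ with h | h | h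
  · exact Or.inl (le_of_lt h)
  · exact Or.inl (le_of_eq (congrArg Subtype.val h))
  · exact Or.inr (le_of_lt h)

theorem lt_of_not_le_of_le [IsTree Υ] {x y t : Υ} (hx : x ≤ t) (hy : y ≤ t) (h : ¬ x ≤ y) :
    y < x :=
  lt_of_le_not_ge ((le_or_le_of_le hx hy).resolve_left h) h

instance (priority := 100) IsTree.wellFoundedLT [IsTree Υ] : WellFoundedLT Υ := by
  refine ⟨⟨fun t => ?_⟩⟩
  have := IsTree.isWellOrder_Iic t
  have wf : WellFounded ((· < ·) : Iic t → Iic t → Prop) := IsWellFounded.wf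
  have key : ∀ x : Iic t, Acc ((· < ·) : Υ → Υ → Prop) x := by
    intro x
    induction x using wf.induction with
    | _ x ih => exact ⟨_, fun y hy => ih ⟨y, hy.le.trans x.2⟩ hy⟩
  exact key ⟨t, le_rfl⟩

/-- A nonempty set of points below `t` has a least element. -/
theorem exists_isLeast [IsTree Υ] {C : Set Υ} {t : Υ} (hC : C.Nonempty) (ht : C ⊆ Iic t) :
    ∃ m, IsLeast C m := by
  obtain ⟨m, hm, hmin⟩ := WellFounded.has_min (wellFounded_lt (α := Υ)) C hC
  refine ⟨m, hm, fun y hy => ?_⟩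
  by_contra h
  exact hmin y hy (lt_of_not_le_of_le (ht hm) (ht hy) h)

theorem exists_covBy_le [IsTree Υ] {s t : Υ} (h : s < t) : ∃ v, s ⋖ v ∧ v ≤ t := by
  obtain ⟨m, ⟨hm, hmt⟩, hl⟩ := exists_isLeast (C := {y | s < y ∧ y ≤ t}) (t := t) ⟨t, h, le_rfl⟩
    fun y hy => hy.2
  exact ⟨m, ⟨hm, fun y hy hym => absurd (hl ⟨hy, hym.le.trans hmt⟩) hym.not_ge⟩, hmt⟩

theorem covBy_eq_of_le [IsTree Υ] {s v w t : Υ} (hv : s ⋖ v) (hw : s ⋖ w) (hvt : v ≤ t)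
    (hwt : w ≤ t) : v = w := by
  rcases le_or_le_of_le hvt hwt with h | h
  · exact hw.eq_or_eq hv.le h |>.resolve_left hv.lt.ne'
  · exact (hv.eq_or_eq hw.le h |>.resolve_left hw.lt.ne').symm

theorem covBy_left_unique [IsTree Υ] {s s' v : Υ} (h : s ⋖ v) (h' : s' ⋖ v) : s = s' := by
  rcases le_or_le_of_le h.le h'.le with hs | hs
  · exact (h.eq_or_eq hs h'.le |>.resolve_right h'.lt.ne).symm
  · exact h'.eq_or_eq hs h.le |>.resolve_right h.lt.ne

theorem CovBy.not_isSuccLimit {s v : Υ} (h : s ⋖ v) : ¬ Order.IsSuccLimit v :=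
  fun hv => hv.isSuccPrelimit s h

theorem isSuccLimit_of_forall_lt {w : Υ} (hne : ∃ x, x < w) (h : ∀ x < w, ∃ y, x < y ∧ y < w) :
    Order.IsSuccLimit w := by
  refine ⟨fun hmin => ?_, fun x hx => ?_⟩
  · obtain ⟨x, hx⟩ := hne
    exact hx.not_ge (hmin hx.le)
  · obtain ⟨y, hy, hyw⟩ := h x hx.lt
    exact hx.2 hy hyw

theorem exists_covBy_of_not_isSuccLimit {w : Υ} (h : ¬ Order.IsSuccLimit w) :
    (∀ x, ¬ x < w) ∨ ∃ x, x ⋖ w := by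
  rcases Order.not_isSuccLimit_iff.1 h with h | h
  · exact Or.inl fun x hx => hx.not_ge (h hx.le)
  · simp only [Order.IsSuccPrelimit, not_forall, not_not] at h
    exact Or.inr h

theorem IsSuccLimit.exists_lt {w : Υ} (h : Order.IsSuccLimit w) : ∃ x, x < w :=
  h.nonempty_Iio

theorem IsSuccLimit.exists_between' {w x : Υ} (h : Order.IsSuccLimit w) (hx : x < w) :
    ∃ y, x < y ∧ y < w := by
  by_contra! hc
  exact h.isSuccPrelimit x ⟨hx, fun y hy hyw => hc y hy hyw⟩

/-- In a Hausdorff tree, an upper bound of all points below a limit point `w` that is not excluded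
by being in another branch is above `w`. -/
theorem IsSuccLimit.le_of_forall_lt [IsHausdorffTree Υ] {w r : Υ} (hw : Order.IsSuccLimit w)
    (h : ∀ x < w, x ≤ r) : w ≤ r := by
  by_cases hne : ∃ y, y ≤ r ∧ ¬ y < w
  · obtain ⟨m, ⟨hmr, hmw⟩, hl⟩ := exists_isLeast (C := {y | y ≤ r ∧ ¬ y < w}) (t := r) hne
      fun y hy => hy.1
    have : Iio m = Iio w := by
      ext z
      constructor
      · intro hz
        by_contra hzw
        exact absurd (hl ⟨(le_of_lt hz).trans hmr, hzw⟩) (not_le_of_gt hz)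
      · intro hz
        exact lt_of_not_le_of_le hmr (h z hz) fun hmz => hmw (lt_of_le_of_lt hmz hz)
    have hmw := IsHausdorffTree.eq_of_Iio_eq w m hw this
    exact hmw ▸ hmr
  · push Not at hne
    obtain ⟨y, hy, hyw⟩ := IsSuccLimit.exists_between' hw (hne r le_rfl)
    exact absurd (h y hyw) hy.not_ge

theorem IsSuccLimit.exists_lt_not_le [IsHausdorffTree Υ] {w r : Υ} (hw : Order.IsSuccLimit w)
    (h : ¬ w ≤ r) : ∃ x < w, ¬ x ≤ r := by
  by_contra! hc
  exact h (IsSuccLimit.le_of_forall_lt hw hc)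

/-- A nonempty set of points below `t` has a least upper bound, which belongs to the set or is a
limit point of it. -/
theorem exists_isLUB [IsTree Υ] {C : Set Υ} {t : Υ} (hC : C.Nonempty) (ht : C ⊆ Iic t) :
    ∃ w ≤ t, (∀ c ∈ C, c ≤ w) ∧
      (w ∈ C ∨ (Order.IsSuccLimit w ∧ ∀ x < w, ∃ c ∈ C, x < c)) := by
  obtain ⟨w, ⟨hwt, hub⟩, hl⟩ := exists_isLeast (C := {y | y ≤ t ∧ ∀ c ∈ C, c ≤ y}) (t := t)
    ⟨t, le_rfl, fun c hc => ht hc⟩ fun y hy => hy.1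
  refine ⟨w, hwt, hub, or_iff_not_imp_left.2 fun hw => ?_⟩
  have cof : ∀ x < w, ∃ c ∈ C, x < c := by
    intro x hx
    by_contra! hc
    have : ∀ c ∈ C, c ≤ x := fun c hcC => by
      by_contra hcx
      exact hc c hcC (lt_of_not_le_of_le (ht hcC) (hx.le.trans hwt) hcx)
    exact absurd (hl ⟨hx.le.trans hwt, this⟩) hx.not_ge
  refine ⟨isSuccLimit_of_forall_lt ?_ fun x hx => ?_, cof⟩
  · obtain ⟨c, hc⟩ := hC
    exact ⟨c, lt_of_le_of_ne (hub c hc) fun h => hw (h ▸ hc)⟩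
  · obtain ⟨c, hc, hxc⟩ := cof x hx
    exact ⟨c, hxc, lt_of_le_of_ne (hub c hc) fun h => hw (h ▸ hc)⟩

/-- Take the supremum w of the lower bounds inside some (0,y]. If w is a limit of lower bounds, the
Hausdorff condition keeps w below every element of `B`. -/
theorem exists_isGLB [IsHausdorffTree Υ] {B : Set Υ} {t : Υ} (hB : B.Nonempty)
    (ht : ∀ b ∈ B, t ≤ b) : ∃ m, IsGLB B m := by
  obtain ⟨y, hy⟩ := hB
  obtain ⟨w, hwy, hub, h⟩ := exists_isLUB (C := lowerBounds B) (t := y) ⟨t, ht⟩ fun c hc => hc hy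
  refine ⟨w, fun b hb => ?_, hub⟩
  rcases h with h | ⟨hlim, hcof⟩
  · exact h hb
  · refine IsSuccLimit.le_of_forall_lt hlim fun x hx => ?_
    obtain ⟨c, hc, hxc⟩ := hcof x hx
    exact hxc.le.trans (hc hb)

theorem Ioc_eq_sdiff [IsTree Υ] {x w : Υ} (h : x ≤ w) : Ioc x w = Iic w \ Iic x := by
  ext y
  exact ⟨fun hy => ⟨hy.2, hy.1.not_ge⟩, fun hy => ⟨lt_of_not_le_of_le hy.1 h hy.2, hy.1⟩⟩

end TreeOrder

/-! ### The tree topology -/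

section TreeTopology

variable {Υ : Type*} [PartialOrder Υ] [TopologicalSpace Υ] [IsTreeTopology Υ]

theorem isOpen_Iic (t : Υ) : IsOpen (Iic t) := by
  rw [IsTreeTopology.eq_generateFrom (Υ := Υ)]
  exact TopologicalSpace.isOpen_generateFrom_of_mem ⟨t, Or.inl rfl⟩

theorem isClosed_Iic_tree (t : Υ) : IsClosed (Iic t) := by
  rw [← isOpen_compl_iff, IsTreeTopology.eq_generateFrom (Υ := Υ)]
  exact TopologicalSpace.isOpen_generateFrom_of_mem ⟨t, Or.inr rfl⟩

theorem isOpen_Ioc_tree [IsTree Υ] {x w : Υ} (h : x ≤ w) : IsOpen (Ioc x w) := by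
  rw [Ioc_eq_sdiff h]
  exact (isOpen_Iic w).sdiff (isClosed_Iic_tree x)

theorem Ioc_mem_nhds_tree [IsTree Υ] {x w : Υ} (h : x < w) : Ioc x w ∈ 𝓝 w :=
  (isOpen_Ioc_tree h.le).mem_nhds ⟨h, le_rfl⟩

theorem singleton_mem_nhds_of_not_isSuccLimit [IsTree Υ] {w : Υ} (hw : ¬ Order.IsSuccLimit w) :
    {w} ∈ 𝓝 w := by
  rcases exists_covBy_of_not_isSuccLimit hw with h | ⟨x, hx⟩
  · refine mem_of_superset ((isOpen_Iic w).mem_nhds le_rfl) fun y (hy : y ≤ w) => ?_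
    exact (lt_or_eq_of_le hy).resolve_left (h y)
  · refine mem_of_superset (Ioc_mem_nhds_tree hx.lt) fun y hy => ?_
    exact (hx.eq_or_eq hy.1.le hy.2).resolve_left hy.1.ne'

/-- It suffices that the filter generated by the intervals (x,w], x < w, converges to w, which is
tested on the subbasis. The Hausdorff condition enters for the complements of the sets (0,r]. -/
theorem exists_Ioc_subset_of_mem_nhds [IsHausdorffTree Υ] {w : Υ} (hw : Order.IsSuccLimit w)
    {U : Set Υ} (hU : U ∈ 𝓝 w) : ∃ x < w, Ioc x w ⊆ U := by
  let l : Filter Υ :=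
    { sets := {U | ∃ x < w, Ioc x w ⊆ U}
      univ_sets := by
        obtain ⟨x, hx⟩ := IsSuccLimit.exists_lt hw
        exact ⟨x, hx, subset_univ _⟩
      sets_of_superset := fun ⟨x, hx, h⟩ h' => ⟨x, hx, h.trans h'⟩
      inter_sets := by
        rintro A B ⟨x, hx, hA⟩ ⟨y, hy, hB⟩
        rcases le_or_le_of_le hx.le hy.le with h | h
        · exact ⟨y, hy, fun z hz => ⟨hA ⟨h.trans_lt hz.1, hz.2⟩, hB hz⟩⟩
        · exact ⟨x, hx, fun z hz => ⟨hA hz, hB ⟨h.trans_lt hz.1, hz.2⟩⟩⟩ }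
  have hl : Tendsto id l (𝓝 w) := by
    rw [IsTreeTopology.eq_generateFrom (Υ := Υ), TopologicalSpace.tendsto_nhds_generateFrom_iff]
    rintro s ⟨r, rfl | rfl⟩ hws
    · obtain ⟨x, hx⟩ := IsSuccLimit.exists_lt hw
      exact ⟨x, hx, fun y hy => hy.2.trans hws⟩
    · obtain ⟨x, hx, hxr⟩ := IsSuccLimit.exists_lt_not_le hw hws
      exact ⟨x, hx, fun y hy hyr => hxr (hy.1.le.trans hyr)⟩
  exact hl hU

/-- Induction on t: a member of the cover containing t contains some (x,t], and (0,x] is already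
compact. At a minimal t one member is enough. -/
theorem isCompact_Iic_tree [IsHausdorffTree Υ] (t : Υ) : IsCompact (Iic t) := by
  induction t using (wellFounded_lt (α := Υ)).induction with
  | _ t ih =>
    refine isCompact_of_finite_subcover fun {ι} U hU hcov => ?_
    obtain ⟨i, hi⟩ := mem_iUnion.1 (hcov (show t ∈ Iic t from le_rfl))
    by_cases hlt : ∃ x < t, Ioc x t ⊆ U i
    · obtain ⟨x, hx, hxU⟩ := hlt
      obtain ⟨s, hs⟩ := (ih x hx).elim_finite_subcover U hU
        ((Iic_subset_Iic.2 hx.le).trans hcov)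
      classical
      refine ⟨insert i s, fun y (hy : y ≤ t) => ?_⟩
      rw [Finset.set_biUnion_insert]
      by_cases hyx : y ≤ x
      · exact Or.inr (hs hyx)
      · exact Or.inl (hxU ⟨lt_of_not_le_of_le hy hx.le hyx, hy⟩)
    · have hnl : ¬ Order.IsSuccLimit t := fun h =>
        hlt (exists_Ioc_subset_of_mem_nhds h ((hU i).mem_nhds hi))
      rcases exists_covBy_of_not_isSuccLimit hnl with hmin | ⟨x, hx⟩
      · refine ⟨{i}, fun y (hy : y ≤ t) => ?_⟩
        simpa [(lt_or_eq_of_le hy).resolve_left (hmin y)] using hi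
      · refine absurd ⟨x, hx.lt, fun y hy => ?_⟩ hlt
        rw [(hx.eq_or_eq hy.1.le hy.2).resolve_left hy.1.ne']
        exact hi

theorem IsCompact.exists_finite_subset_iUnion_Iic {K : Set Υ} (hK : IsCompact K) :
    ∃ s : Finset Υ, ∀ x ∈ K, ∃ t ∈ s, x ≤ t := by
  obtain ⟨s, hs⟩ := hK.elim_finite_subcover (fun t : Υ => Iic t) isOpen_Iic
    fun x _ => mem_iUnion.2 ⟨x, le_rfl⟩
  refine ⟨s, fun x hx => ?_⟩
  simpa using hs hx

end TreeTopology

/-! ### Continuous functions on a tree and density of the span of the indicators -/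

section Functions

variable {Υ : Type*} [PartialOrder Υ] [TopologicalSpace Υ] [IsTreeTopology Υ]

theorem abs_apply_le_norm {Ω : Type*} [TopologicalSpace Ω] (f : C₀(Ω, ℝ)) (x : Ω) :
    |f x| ≤ ‖f‖ := by
  rw [← ZeroAtInftyContinuousMap.norm_toBCF_eq_norm]
  exact f.toBCF.norm_coe_le_norm x

theorem norm_le_of_forall_abs_le {Ω : Type*} [TopologicalSpace Ω] {f : C₀(Ω, ℝ)} {C : ℝ}
    (hC : 0 ≤ C) (h : ∀ x, |f x| ≤ C) : ‖f‖ ≤ C := by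
  rw [← ZeroAtInftyContinuousMap.norm_toBCF_eq_norm]
  exact (BoundedContinuousFunction.norm_le hC).2 h

/-- Evaluation at a point, as a continuous linear functional. -/
noncomputable def evalCLM {Ω : Type*} [TopologicalSpace Ω] (x : Ω) : C₀(Ω, ℝ) →L[ℝ] ℝ :=
  LinearMap.mkContinuous
    { toFun := fun f => f x
      map_add' := fun _ _ => rfl
      map_smul' := fun _ _ => rfl } 1 fun f => by
    rw [one_mul]; exact abs_apply_le_norm f x

@[simp]
theorem evalCLM_apply {Ω : Type*} [TopologicalSpace Ω] (x : Ω) (f : C₀(Ω, ℝ)) :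
    evalCLM x f = f x := rfl

/-- The value at a point, or zero if there is no point. -/
noncomputable def optEval {Ω : Type*} [TopologicalSpace Ω] (o : Option Ω) : C₀(Ω, ℝ) →L[ℝ] ℝ :=
  o.elim 0 evalCLM

@[simp]
theorem optEval_none {Ω : Type*} [TopologicalSpace Ω] (f : C₀(Ω, ℝ)) : optEval none f = 0 := rfl

@[simp]
theorem optEval_some {Ω : Type*} [TopologicalSpace Ω] (x : Ω)
    (f : C₀(Ω, ℝ)) : optEval (some x) f = f x := rfl

theorem abs_optEval_le {Ω : Type*} [TopologicalSpace Ω] (o : Option Ω)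
    (f : C₀(Ω, ℝ)) : |optEval o f| ≤ ‖f‖ := by
  cases o with
  | none => simp
  | some x => exact abs_apply_le_norm f x

theorem exists_finset_forall_abs_lt (f : C₀(Υ, ℝ)) {ε : ℝ} (hε : 0 < ε) :
    ∃ s : Finset Υ, ∀ x, ε ≤ |f x| → ∃ t ∈ s, x ≤ t := by
  have h := f.zero_at_infty' (Metric.ball_mem_nhds (0 : ℝ) hε)
  obtain ⟨K, hK, hKs⟩ := mem_cocompact.1 h
  obtain ⟨s, hs⟩ := IsCompact.exists_finite_subset_iUnion_Iic hK
  refine ⟨s, fun x hx => hs x ?_⟩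
  by_contra hxK
  have : f x ∈ Metric.ball (0 : ℝ) ε := hKs hxK
  rw [mem_ball_zero_iff, Real.norm_eq_abs] at this
  exact absurd hx (not_le_of_gt this)

theorem exists_Ioc_abs_sub_lt [IsHausdorffTree Υ] (f : C₀(Υ, ℝ)) {w : Υ}
    (hw : Order.IsSuccLimit w) {ε : ℝ} (hε : 0 < ε) :
    ∃ x < w, ∀ y, x < y → y ≤ w → |f y - f w| < ε := by
  obtain ⟨x, hx, h⟩ := exists_Ioc_subset_of_mem_nhds hw
    (f.continuous.continuousAt.preimage_mem_nhds (Metric.ball_mem_nhds (f w) hε))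
  exact ⟨x, hx, fun y hy hyw => by simpa [Real.dist_eq] using h ⟨hy, hyw⟩⟩

theorem eq_of_forall_lt_exists_eq [IsHausdorffTree Υ] (f : C₀(Υ, ℝ)) {w : Υ} {c : ℝ}
    (hw : Order.IsSuccLimit w) (h : ∀ x < w, ∃ y, x < y ∧ y ≤ w ∧ f y = c) : f w = c := by
  by_contra hne
  obtain ⟨x, hx, hxw⟩ := exists_Ioc_abs_sub_lt f hw (abs_pos.2 (sub_ne_zero.2 (Ne.symm hne)))
  obtain ⟨y, hy, hyw, rfl⟩ := h x hx
  exact lt_irrefl _ (hxw y hy hyw)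

/-- A function which does not change at successors between `t` and `m` is constant there. -/
theorem eq_of_forall_covBy_eq [IsHausdorffTree Υ] (f : C₀(Υ, ℝ)) {t m : Υ} (htm : t ≤ m)
    (h : ∀ x y, t ≤ x → x ⋖ y → y ≤ m → f x = f y) : f m = f t := by
  by_contra hne
  obtain ⟨w, ⟨hwm, htw, hw⟩, hl⟩ := exists_isLeast
    (C := {y | y ≤ m ∧ t ≤ y ∧ f y ≠ f t}) (t := m) ⟨m, le_rfl, htm, hne⟩ fun y hy => hy.1
  have hbelow : ∀ x < w, t ≤ x → f x = f t := fun x hx htx => by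
    by_contra hxt
    exact absurd (hl ⟨hx.le.trans hwm, htx, hxt⟩) hx.not_ge
  have htw' : t < w := lt_of_le_of_ne htw fun h => hw (h ▸ rfl)
  by_cases hlim : Order.IsSuccLimit w
  · refine hw (eq_of_forall_lt_exists_eq f hlim fun x hx => ?_)
    rcases le_or_le_of_le hx.le htw with hxt | hxt
    · obtain ⟨y, hy, hyw⟩ := IsSuccLimit.exists_between' hlim htw'
      exact ⟨y, hxt.trans_lt hy, hyw.le, hbelow y hyw hy.le⟩
    · obtain ⟨y, hy, hyw⟩ := IsSuccLimit.exists_between' hlim hx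
      exact ⟨y, hy, hyw.le, hbelow y hyw (hxt.trans hy.le)⟩
  · refine hlim (isSuccLimit_of_forall_lt ⟨t, htw'⟩ fun x hx => ?_)
    by_contra! hc
    have hxw : x ⋖ w := ⟨hx, fun z hz hzw => hc z hz hzw⟩
    have htx : t ≤ x := by
      by_contra hn
      exact hc t (lt_of_not_le_of_le htw hx.le hn) htw'
    exact hw ((h x w htx hxw hwm).symm.trans (hbelow x hx htx))

/-- The indicator function of `(0, t]`. -/
noncomputable def indic [IsHausdorffTree Υ] (t : Υ) : C₀(Υ, ℝ) where
  toFun := (Iic t).indicator 1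
  continuous_toFun :=
    (continuous_const (y := (1 : ℝ))).indicator (by
      simp [IsClopen.frontier_eq ⟨isClosed_Iic_tree t, isOpen_Iic t⟩])
  zero_at_infty' := by
    refine tendsto_const_nhds.congr' ?_
    filter_upwards [(isCompact_Iic_tree t).compl_mem_cocompact] with x hx
    exact (indicator_of_notMem hx _).symm

theorem indic_of_le [IsHausdorffTree Υ] {x t : Υ} (h : x ≤ t) : indic t x = 1 :=
  indicator_of_mem (show x ∈ Iic t from h) _

theorem indic_of_not_le [IsHausdorffTree Υ] {x t : Υ} (h : ¬ x ≤ t) : indic t x = 0 :=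
  indicator_of_notMem (show x ∉ Iic t from h) _

theorem abs_indic_le_one [IsHausdorffTree Υ] (x t : Υ) : |indic t x| ≤ 1 := by
  by_cases h : x ≤ t
  · simp [indic_of_le h]
  · simp [indic_of_not_le h]

theorem norm_indic_le_one [IsHausdorffTree Υ] (t : Υ) : ‖indic t‖ ≤ 1 :=
  norm_le_of_forall_abs_le zero_le_one fun x => abs_indic_le_one x t

/-- Induction on t. At a limit, f is nearly constant on some (x,t], so the product is close to `f *
indic x + f t • (indic t - indic x)`; when x is the predecessor of t, this is exact. -/
theorem mul_indic_mem [IsHausdorffTree Υ] {V : Submodule ℝ C₀(Υ, ℝ)}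
    (hV : IsClosed (V : Set C₀(Υ, ℝ))) (h : ∀ t, indic t ∈ V) (f : C₀(Υ, ℝ)) (t : Υ) :
    f * indic t ∈ V := by
  induction t using (wellFounded_lt (α := Υ)).induction with
  | _ t ih =>
    by_cases hlim : Order.IsSuccLimit t
    · rw [← SetLike.mem_coe, ← hV.closure_eq, Metric.mem_closure_iff]
      intro ε hε
      obtain ⟨x, hx, hxt⟩ := exists_Ioc_abs_sub_lt f hlim (half_pos hε)
      refine ⟨f * indic x + f t • (indic t - indic x),
        V.add_mem (ih x hx) (V.smul_mem _ (V.sub_mem (h t) (h x))), ?_⟩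
      rw [dist_eq_norm]
      refine lt_of_le_of_lt (norm_le_of_forall_abs_le (half_pos hε).le fun y => ?_)
        (half_lt_self hε)
      simp only [ZeroAtInftyContinuousMap.coe_sub, ZeroAtInftyContinuousMap.coe_add,
        ZeroAtInftyContinuousMap.coe_mul, ZeroAtInftyContinuousMap.coe_smul, Pi.sub_apply,
        Pi.add_apply, Pi.mul_apply, Pi.smul_apply, smul_eq_mul]
      by_cases hyx : y ≤ x
      · simp [indic_of_le hyx, indic_of_le (hyx.trans hx.le), (half_pos hε).le]
      · by_cases hyt : y ≤ t
        · simpa [indic_of_le hyt, indic_of_not_le hyx] using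
            (hxt y (lt_of_not_le_of_le hyt hx.le hyx) hyt).le
        · simp [indic_of_not_le hyt, indic_of_not_le hyx, (half_pos hε).le]
    · rcases exists_covBy_of_not_isSuccLimit hlim with hmin | ⟨x, hx⟩
      · have : f * indic t = f t • indic t := by
          ext y
          by_cases hyt : y ≤ t
          · simp [(lt_or_eq_of_le hyt).resolve_left (hmin y)]
          · simp [indic_of_not_le hyt]
        rw [this]
        exact V.smul_mem _ (h t)
      · have : f * indic t = f * indic x + f t • (indic t - indic x) := by
          ext y
          simp only [ZeroAtInftyContinuousMap.coe_sub, ZeroAtInftyContinuousMap.coe_add,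
            ZeroAtInftyContinuousMap.coe_mul, ZeroAtInftyContinuousMap.coe_smul, Pi.sub_apply,
            Pi.add_apply, Pi.mul_apply, Pi.smul_apply, smul_eq_mul]
          by_cases hyx : y ≤ x
          · simp [indic_of_le hyx, indic_of_le (hyx.trans hx.le)]
          · by_cases hyt : y ≤ t
            · rw [(hx.eq_or_eq (lt_of_not_le_of_le hyt hx.le hyx).le hyt).resolve_left
                fun h => hyx h.le]
              simp [indic_of_le le_rfl, indic_of_not_le hx.lt.not_ge]
            · simp [indic_of_not_le hyt, indic_of_not_le hyx]
        rw [this]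
        exact V.add_mem (ih x hx.lt) (V.smul_mem _ (V.sub_mem (h t) (h x)))

/-- A closed subspace which contains the indicators of the sets `(0, t]` is everything. -/
theorem mem_of_forall_indic_mem [IsHausdorffTree Υ] {V : Submodule ℝ C₀(Υ, ℝ)}
    (hV : IsClosed (V : Set C₀(Υ, ℝ))) (h : ∀ t, indic t ∈ V) (f : C₀(Υ, ℝ)) : f ∈ V := by
  classical
  -- Multiplying f by the complements of finitely many sets (0,t] changes it only by elements of V.
  have key : ∀ s : Finset Υ, ∃ g : C₀(Υ, ℝ), f - g ∈ V ∧
      ∀ x, (g x = f x ∨ g x = 0) ∧ ((∃ t ∈ s, x ≤ t) → g x = 0) := by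
    intro s
    induction s using Finset.induction_on with
    | empty => exact ⟨f, by simp, fun x => ⟨Or.inl rfl, by simp⟩⟩
    | insert t s hts ih =>
      obtain ⟨g, hg, hgx⟩ := ih
      refine ⟨g - g * indic t, ?_, fun x => ?_⟩
      · have : f - (g - g * indic t) = (f - g) + g * indic t := by abel
        rw [this]
        exact V.add_mem hg (mul_indic_mem hV h g t)
      · simp only [ZeroAtInftyContinuousMap.coe_sub, ZeroAtInftyContinuousMap.coe_mul,
          Pi.sub_apply, Pi.mul_apply]
        by_cases hxt : x ≤ t
        · simp [indic_of_le hxt]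
        · refine ⟨by simpa [indic_of_not_le hxt] using (hgx x).1, ?_⟩
          rintro ⟨y, hy, hxy⟩
          rcases Finset.mem_insert.1 hy with rfl | hy
          · exact absurd hxy hxt
          · simp [(hgx x).2 ⟨y, hy, hxy⟩]
  rw [← SetLike.mem_coe, ← hV.closure_eq, Metric.mem_closure_iff]
  intro ε hε
  obtain ⟨s, hs⟩ := exists_finset_forall_abs_lt f (half_pos hε)
  obtain ⟨g, hg, hgx⟩ := key s
  refine ⟨f - g, hg, ?_⟩
  rw [dist_eq_norm, sub_sub_cancel]
  refine lt_of_le_of_lt (norm_le_of_forall_abs_le (half_pos hε).le fun x => ?_) (half_lt_self hε)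
  by_cases hx : ε / 2 ≤ |f x|
  · simp [(hgx x).2 (hs x hx), (half_pos hε).le]
  · rcases (hgx x).1 with h | h
    · exact h ▸ (not_le.1 hx).le
    · simp [h, (half_pos hε).le]

end Functions

/-! ### From a strictly convex norm to a potential -/

section EquivalentNorm

variable {X : Type*} [NormedAddCommGroup X] [NormedSpace ℝ X]

theorem seminorm_le_add_mul_norm_sub {p : Seminorm ℝ X} {C : ℝ} (hC : ∀ x, p x ≤ C * ‖x‖)
    (x y : X) : p x ≤ p y + C * ‖x - y‖ := by
  calc p x = p (y + (x - y)) := by rw [add_sub_cancel]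
    _ ≤ p y + p (x - y) := map_add_le_add p _ _
    _ ≤ _ := by gcongr; exact hC _

theorem IsStrictlyConvexNorm.eq_of_half_add {p : Seminorm ℝ X} (hp : IsStrictlyConvexNorm p)
    {x y : X} {c : ℝ} (hx : p x ≤ c) (hy : p y ≤ c) (h : c ≤ p ((1 / 2 : ℝ) • (x + y))) :
    x = y := by
  rw [map_smul_eq_mul, Real.norm_of_nonneg (by norm_num)] at h
  have := map_add_le_add p x y
  exact hp x y (by linarith) (by linarith)

end EquivalentNorm

section Phi

variable {Υ : Type*} [PartialOrder Υ] [TopologicalSpace Υ]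

/-- The functions which are `1` on `(0, t]` and vanish outside `(0, t] ∪ [t, ∞)`. -/
def headSet (t : Υ) : Set C₀(Υ, ℝ) :=
  {f | (∀ x, x ≤ t → f x = 1) ∧ ∀ x, ¬ x ≤ t → ¬ t ≤ x → f x = 0}

/-- The infimum of the norm `p` over the functions with head `(0, t]`. -/
noncomputable def headInf (p : Seminorm ℝ C₀(Υ, ℝ)) (t : Υ) : ℝ := sInf (p '' headSet t)

theorem headInf_le {p : Seminorm ℝ C₀(Υ, ℝ)} {t : Υ} {f : C₀(Υ, ℝ)} (hf : f ∈ headSet t) :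
    headInf p t ≤ p f :=
  csInf_le ⟨0, by rintro _ ⟨g, -, rfl⟩; exact apply_nonneg p g⟩ ⟨f, hf, rfl⟩

theorem half_add_mem_headSet {t : Υ} {f g : C₀(Υ, ℝ)} (hf : f ∈ headSet t) (hg : g ∈ headSet t) :
    (1 / 2 : ℝ) • (f + g) ∈ headSet t := by
  refine ⟨fun x hx => ?_, fun x hx hx' => ?_⟩
  · simp [hf.1 x hx, hg.1 x hx]; norm_num
  · simp [hf.2 x hx hx', hg.2 x hx hx']

theorem isClosed_headSet (t : Υ) : IsClosed (headSet t) := by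
  have hc : ∀ x : Υ, Continuous fun f : C₀(Υ, ℝ) => f x := fun x => (evalCLM x).continuous
  have : headSet t = (⋂ x, ⋂ (_ : x ≤ t), {f : C₀(Υ, ℝ) | f x = 1}) ∩
      ⋂ x, ⋂ (_ : ¬ x ≤ t), ⋂ (_ : ¬ t ≤ x), {f : C₀(Υ, ℝ) | f x = 0} := by
    ext f; simp [headSet]
  rw [this]
  refine IsClosed.inter ?_ ?_
  · exact isClosed_iInter fun x => isClosed_iInter fun _ => isClosed_eq (hc x) continuous_const
  · exact isClosed_iInter fun x => isClosed_iInter fun _ => isClosed_iInter fun _ =>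
      isClosed_eq (hc x) continuous_const

theorem abs_half_add_le_of_disjoint {a b B : ℝ} (ha : |a| ≤ B) (hb : |b| ≤ B)
    (h : a = 0 ∨ b = 0) : |1 / 2 * (a + b)| ≤ 1 / 2 * B := by
  rw [abs_mul, abs_of_pos (by norm_num : (0 : ℝ) < 1 / 2)]
  rcases h with rfl | rfl <;> simp <;> assumption

variable [IsHausdorffTree Υ]

theorem headSet_mono {s t : Υ} (h : s ≤ t) : headSet t ⊆ (headSet s : Set C₀(Υ, ℝ)) := by
  refine fun f hf => ⟨fun x hx => hf.1 x (hx.trans h), fun x hx hx' => hf.2 x ?_ ?_⟩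
  · intro hxt
    exact (le_or_le_of_le hxt h).elim hx hx'
  · exact fun htx => hx' (h.trans htx)

variable [IsTreeTopology Υ]

theorem indic_mem_headSet (t : Υ) : indic t ∈ headSet t :=
  ⟨fun _ hx => indic_of_le hx, fun _ hx _ => indic_of_not_le hx⟩

theorem headInf_mono (p : Seminorm ℝ C₀(Υ, ℝ)) : Monotone (headInf p) := by
  intro s t h
  refine le_csInf ⟨p (indic t), indic t, indic_mem_headSet t, rfl⟩ ?_
  rintro _ ⟨f, hf, rfl⟩
  exact headInf_le (headSet_mono h hf)

theorem exists_mem_headSet_lt (p : Seminorm ℝ C₀(Υ, ℝ)) (t : Υ) {c : ℝ} (h : headInf p t < c) :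
    ∃ f ∈ headSet t, p f < c := by
  obtain ⟨_, ⟨f, hf, rfl⟩, h⟩ := exists_lt_of_csInf_lt (s := p '' headSet t)
    ⟨p (indic t), indic t, indic_mem_headSet t, rfl⟩ h
  exact ⟨f, hf, h⟩

/-- If `headInf p` is constant on an ever-branching set, the infimum is attained there by a system
of functions in which each one is the mean of two later ones. -/
theorem exists_attaining_of_branching {p : Seminorm ℝ C₀(Υ, ℝ)} (hp : IsEquivalentNorm p)
    {Γ : Set Υ} {c : ℝ} (hc : ∀ t ∈ Γ, headInf p t = c) (a b : Γ → Γ)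
    (ha : ∀ t : Γ, (t : Υ) ≤ a t) (hb : ∀ t : Γ, (t : Υ) ≤ b t)
    (hab : ∀ t : Γ, ¬ (a t : Υ) ≤ b t ∧ ¬ (b t : Υ) ≤ a t) :
    ∃ f : Γ → C₀(Υ, ℝ), ∀ t : Γ, f t ∈ headSet (t : Υ) ∧ p (f t) ≤ c ∧
      f t = (1 / 2 : ℝ) • (f (a t) + f (b t)) := by
  obtain ⟨k, C, hk, hC, hpk⟩ := hp
  let Ψ : (Γ → C₀(Υ, ℝ)) → Γ → C₀(Υ, ℝ) := fun g t => (1 / 2 : ℝ) • (g (a t) + g (b t))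
  have hΨhead : ∀ g : Γ → C₀(Υ, ℝ), (∀ t : Γ, g t ∈ headSet (t : Υ)) →
      ∀ t : Γ, Ψ g t ∈ headSet (t : Υ) := fun g hg t =>
    half_add_mem_headSet (headSet_mono (ha t) (hg _)) (headSet_mono (hb t) (hg _))
  have hΨp : ∀ (g : Γ → C₀(Υ, ℝ)) (d : ℝ), (∀ t, p (g t) ≤ d) → ∀ t, p (Ψ g t) ≤ d := by
    intro g d hg t
    have h1 := map_add_le_add p (g (a t)) (g (b t))
    have h2 := hg (a t)
    have h3 := hg (b t)
    simp only [Ψ, map_smul_eq_mul, Real.norm_of_nonneg (by norm_num : (0 : ℝ) ≤ 1 / 2)]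
    linarith
  -- Two functions with head (0,s] differ only on [s,∞). The sets [a t,∞) and [b t,∞) are disjoint,
  -- so averaging halves the distance.
  have hcontr : ∀ (g g' : Γ → C₀(Υ, ℝ)) (B : ℝ), (∀ t : Γ, g t ∈ headSet (t : Υ)) →
      (∀ t : Γ, g' t ∈ headSet (t : Υ)) → (∀ t, ‖g t - g' t‖ ≤ B) →
      ∀ t, ‖Ψ g t - Ψ g' t‖ ≤ 1 / 2 * B := by
    intro g g' B hg hg' hB t
    have hB0 : 0 ≤ B := (norm_nonneg _).trans (hB t)
    refine norm_le_of_forall_abs_le (by positivity) fun x => ?_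
    have hz : ∀ s : Γ, ¬ (s : Υ) ≤ x → (g s - g' s) x = 0 := by
      intro s hs
      by_cases hxs : x ≤ s
      · simp [(hg s).1 x hxs, (hg' s).1 x hxs]
      · simp [(hg s).2 x hxs hs, (hg' s).2 x hxs hs]
    have := abs_half_add_le_of_disjoint ((abs_apply_le_norm _ x).trans (hB (a t)))
      ((abs_apply_le_norm _ x).trans (hB (b t))) (by
        by_cases h : (a t : Υ) ≤ x
        · refine Or.inr (hz _ fun h' => ?_)
          exact (le_or_le_of_le h h').elim (hab t).1 (hab t).2
        · exact Or.inl (hz _ h))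
    convert this using 2
    simp [Ψ]
    ring
  let G : ℕ → Γ → C₀(Υ, ℝ) := fun n => Ψ^[n] fun t => indic (t : Υ)
  have hG : ∀ (n : ℕ) (t : Γ), G (n + 1) t = Ψ (G n) t := fun n t => by
    simp only [G, Function.iterate_succ_apply']
  have hGhead : ∀ (n : ℕ) (t : Γ), G n t ∈ headSet (t : Υ) := by
    intro n
    induction n with
    | zero => exact fun t => indic_mem_headSet _
    | succ n ih => exact fun t => hG n t ▸ hΨhead _ ih t
  have hcau : ∀ (n : ℕ) (t : Γ), ‖G n t - G (n + 1) t‖ ≤ 2 * (1 / 2) ^ n := by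
    intro n
    induction n with
    | zero =>
      intro t
      have h0 : ‖G 0 t‖ ≤ 1 := norm_indic_le_one _
      have h1 : ‖G 1 t‖ ≤ 1 := by
        rw [hG]
        simp only [Ψ]
        rw [norm_smul, Real.norm_of_nonneg (by norm_num : (0 : ℝ) ≤ 1 / 2)]
        have := norm_add_le (G 0 (a t)) (G 0 (b t))
        have h2 : ‖G 0 (a t)‖ ≤ 1 := norm_indic_le_one _
        have h3 : ‖G 0 (b t)‖ ≤ 1 := norm_indic_le_one _
        linarith
      have := norm_sub_le (G 0 t) (G 1 t)
      simp only [pow_zero, mul_one, zero_add]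
      linarith
    | succ n ih =>
      intro t
      rw [hG, hG]
      refine (hcontr _ _ _ (hGhead n) (hGhead (n + 1)) ih t).trans (le_of_eq ?_)
      ring
  have hlim : ∀ t : Γ, ∃ f, Tendsto (fun n => G n t) atTop (𝓝 f) := fun t =>
    cauchySeq_tendsto_of_complete (cauchySeq_of_le_geometric (1 / 2) 2 (by norm_num) fun n => by
      rw [dist_eq_norm]; exact hcau n t)
  choose f hf using hlim
  refine ⟨f, fun t => ⟨(isClosed_headSet _).mem_of_tendsto (hf t)
    (Eventually.of_forall fun n => hGhead n t), ?_, ?_⟩⟩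
  -- Iterates started from near-minimisers keep `p` at most c + ε/2 and, by the contraction, have
  -- the same limit as the iterates of the indicators.
  · refine le_of_forall_pos_le_add fun ε hε => ?_
    have he : ∀ s : Γ, ∃ e ∈ headSet (s : Υ), p e < c + ε / 2 := fun s =>
      exists_mem_headSet_lt p _ (by rw [hc s s.2]; linarith)
    choose e he hpe using he
    let E : ℕ → Γ → C₀(Υ, ℝ) := fun n => Ψ^[n] e
    have hE : ∀ (n : ℕ) (s : Γ), E (n + 1) s = Ψ (E n) s := fun n s => by
      simp only [E, Function.iterate_succ_apply']
    have hEhead : ∀ (n : ℕ) (s : Γ), E n s ∈ headSet (s : Υ) := by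
      intro n
      induction n with
      | zero => exact he
      | succ n ih => exact fun s => hE n s ▸ hΨhead _ ih s
    have hEp : ∀ (n : ℕ) (s : Γ), p (E n s) ≤ c + ε / 2 := by
      intro n
      induction n with
      | zero => exact fun s => (hpe s).le
      | succ n ih => exact fun s => hE n s ▸ hΨp _ _ ih s
    set B : ℝ := 1 + (c + ε / 2) / k
    have hGE : ∀ (n : ℕ) (s : Γ), ‖G n s - E n s‖ ≤ B * (1 / 2) ^ n := by
      intro n
      induction n with
      | zero =>
        intro s
        have h1 : ‖G 0 s‖ ≤ 1 := norm_indic_le_one _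
        have h2 : ‖E 0 s‖ ≤ (c + ε / 2) / k := by
          rw [le_div_iff₀ hk, mul_comm]
          exact (hpk _).1.trans (hpe s).le
        have := norm_sub_le (G 0 s) (E 0 s)
        simp only [pow_zero, mul_one, B]
        linarith
      | succ n ih =>
        intro s
        rw [hG, hE]
        refine (hcontr _ _ _ (hGhead n) (hEhead n) ih s).trans (le_of_eq ?_)
        ring
    have hbound : ∀ n, p (f t) ≤ c + ε / 2 + C * (B * (1 / 2) ^ n) + C * ‖f t - G n t‖ := by
      intro n
      have h1 := seminorm_le_add_mul_norm_sub (fun x => (hpk x).2) (f t) (G n t)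
      have h2 := seminorm_le_add_mul_norm_sub (fun x => (hpk x).2) (G n t) (E n t)
      have h3 := mul_le_mul_of_nonneg_left (hGE n t) hC.le
      linarith [hEp n t]
    have hT : Tendsto (fun n => c + ε / 2 + C * (B * (1 / 2) ^ n) + C * ‖f t - G n t‖) atTop
        (𝓝 (c + ε / 2 + C * (B * 0) + C * 0)) := by
      refine ((tendsto_const_nhds.add (((tendsto_pow_atTop_nhds_zero_of_lt_one (by norm_num)
        (by norm_num)).const_mul B).const_mul C))).add (Tendsto.const_mul C ?_)
      have := (tendsto_const_nhds (x := f t)).sub (hf t)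
      simpa using this.norm
    have := ge_of_tendsto' hT hbound
    simp only [mul_zero, add_zero] at this
    linarith
  · have h1 : Tendsto (fun n => G (n + 1) t) atTop (𝓝 (f t)) :=
      (tendsto_add_atTop_iff_nat 1).2 (hf t)
    have h2 : Tendsto (fun n => G (n + 1) t) atTop
        (𝓝 ((1 / 2 : ℝ) • (f (a t) + f (b t)))) := by
      simp only [hG, Ψ]
      exact ((hf (a t)).add (hf (b t))).const_smul _
    exact tendsto_nhds_unique h1 h2

/-- The minimiser at t is the mean of minimisers at two incomparable points a and b. Strict
convexity identifies these, yet at the point a they take the values 1 and 0. -/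
theorem headInf_not_const_of_isEverBranching {p : Seminorm ℝ C₀(Υ, ℝ)} (hp : IsEquivalentNorm p)
    (hsc : IsStrictlyConvexNorm p) {Γ : Set Υ} (hne : Γ.Nonempty) (hΓ : IsEverBranching Γ) :
    ¬ ∃ c : ℝ, ∀ t ∈ Γ, headInf p t = c := by
  rintro ⟨c, hc⟩
  have : ∀ t : Γ, ∃ a b : Γ, (t : Υ) ≤ a ∧ (t : Υ) ≤ b ∧ ¬ (a : Υ) ≤ b ∧ ¬ (b : Υ) ≤ a := by
    intro t
    have := hΓ t t.2
    simp only [IsChain, Set.Pairwise, not_forall] at this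
    obtain ⟨x, hx, y, hy, -, h⟩ := this
    push Not at h
    exact ⟨⟨x, hx.1⟩, ⟨y, hy.1⟩, hx.2, hy.2, h.1, h.2⟩
  choose a b ha hb hab hba using this
  obtain ⟨f, hf⟩ := exists_attaining_of_branching hp hc a b ha hb fun t => ⟨hab t, hba t⟩
  obtain ⟨t, ht⟩ := hne
  set t' : Γ := ⟨t, ht⟩
  have heq : f (a t') = f (b t') := hsc.eq_of_half_add (hf _).2.1 (hf _).2.1 (by
    rw [← (hf t').2.2, ← hc t ht]
    exact headInf_le (hf t').1)
  have h1 : f (a t') (a t') = 1 := (hf _).1.1 _ le_rfl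
  have h2 : f (b t') (a t') = 0 := (hf _).1.2 _ (hab t') (hba t')
  rw [heq, h2] at h1
  exact zero_ne_one h1

/-- Infinitely many successors v of u have near-minimisers of `p`-norm below c. The mean of n + 1 of
them has norm at most c and differs from the indicator of (0,u] by O(1/n). -/
theorem le_headInf_of_isBadPoint {p : Seminorm ℝ C₀(Υ, ℝ)} (hp : IsEquivalentNorm p) {u : Υ}
    (hu : IsBadPoint (headInf p) u) : p (indic u) ≤ headInf p u := by
  obtain ⟨k, C, hk, hC, hpk⟩ := hp
  refine le_of_forall_pos_le_add fun ε hε => ?_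
  set c := headInf p u + ε / 2 with hcdef
  -- If finite, this set would serve as F with gap ε/2 and make u good.
  have hinf : {v ∈ immSucc u | headInf p v < c}.Infinite := by
    intro hfin
    refine hu ⟨_, hfin, sep_subset _ _, ε / 2, half_pos hε, fun v hv => ?_⟩
    by_contra hlt
    exact hv.2 ⟨hv.1, not_le.1 hlt⟩
  have hc0 : 0 ≤ c := by
    have : 0 ≤ headInf p u := Real.sInf_nonneg (by rintro _ ⟨f, -, rfl⟩; exact apply_nonneg p f)
    positivity
  have he : ∀ v : Υ, ∃ e, (headInf p v < c → e ∈ headSet v ∧ p e < c) := fun v => by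
    by_cases hv : headInf p v < c
    · obtain ⟨e, he⟩ := exists_mem_headSet_lt p v hv
      exact ⟨e, fun _ => he⟩
    · exact ⟨0, fun h => absurd h hv⟩
  choose e he using he
  have hbound : ∀ n : ℕ, p (indic u) ≤ c + C * (c / k + 1) * (1 / ((n : ℝ) + 1)) := by
    intro n
    obtain ⟨s, hs, hcard⟩ := hinf.exists_subset_card_eq (n + 1)
    set B := c / k + 1
    have hB0 : 0 ≤ B := by positivity
    have hn : (0 : ℝ) < (n : ℝ) + 1 := by positivity
    set g : C₀(Υ, ℝ) := (1 / ((n : ℝ) + 1)) • ∑ v ∈ s, e v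
    have hg : p g ≤ c := by
      have h1 : p (∑ v ∈ s, e v) ≤ ∑ v ∈ s, p (e v) :=
        Finset.le_sum_of_subadditive p (map_zero p).le (map_add_le_add p) s e
      have h2 : ∑ v ∈ s, p (e v) ≤ ((n : ℝ) + 1) * c := by
        refine (Finset.sum_le_card_nsmul s _ c fun v hv => (he v (hs hv).2).2.le).trans ?_
        rw [hcard, nsmul_eq_mul]; push_cast; rfl
      rw [map_smul_eq_mul, Real.norm_of_nonneg (by positivity), one_div, inv_mul_le_iff₀ hn]
      exact h1.trans h2
    -- The difference lives on [v,∞), and these sets are disjoint for distinct successors, so at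
    -- each point at most one term of the sum survives.
    have hzero : ∀ v ∈ s, ∀ x, ¬ v ≤ x → e v x - indic u x = 0 := by
      intro v hv x hvx
      have hev := (he v (hs hv).2).1
      have huv : u ⋖ v := (hs hv).1
      by_cases hxu : x ≤ u
      · rw [hev.1 x (hxu.trans huv.le), indic_of_le hxu, sub_self]
      · rw [indic_of_not_le hxu, hev.2 x ?_ hvx, sub_zero]
        intro hxv
        rcases le_or_le_of_le hxv huv.le with h | h
        · exact hxu h
        · rcases huv.eq_or_eq h hxv with rfl | rfl
          · exact hxu le_rfl
          · exact hvx le_rfl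
    have hnorm : ‖indic u - g‖ ≤ B * (1 / ((n : ℝ) + 1)) := by
      refine norm_le_of_forall_abs_le (by positivity) fun x => ?_
      have hgx : (indic u - g) x = -(1 / ((n : ℝ) + 1) * ∑ v ∈ s, (e v x - indic u x)) := by
        have : (∑ v ∈ s, e v) x = ∑ v ∈ s, e v x := map_sum (evalCLM x) e s
        simp only [g, ZeroAtInftyContinuousMap.sub_apply, ZeroAtInftyContinuousMap.smul_apply,
          this, Finset.sum_sub_distrib, Finset.sum_const, hcard, smul_eq_mul, nsmul_eq_mul]
        push_cast
        field_simp
        ring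
      rw [hgx, abs_neg, abs_mul, abs_of_pos (by positivity : 0 < 1 / ((n : ℝ) + 1)), mul_comm]
      refine mul_le_mul_of_nonneg_right ?_ (by positivity)
      by_cases hx : ∃ v ∈ s, v ≤ x
      · obtain ⟨v, hv, hvx⟩ := hx
        rw [Finset.sum_eq_single v (fun w hw hwv => hzero w hw x fun hwx => hwv ?_)
          (fun h => absurd hv h)]
        · have h1 : |e v x| ≤ c / k := by
            refine (abs_apply_le_norm _ x).trans ?_
            rw [le_div_iff₀ hk, mul_comm]
            exact (hpk _).1.trans (he v (hs hv).2).2.le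
          exact (abs_sub _ _).trans (add_le_add h1 (abs_indic_le_one x u))
        · exact covBy_eq_of_le (hs hw).1 (hs hv).1 hwx hvx
      · push Not at hx
        rw [Finset.sum_eq_zero fun v hv => hzero v hv x (hx v hv), abs_zero]
        exact hB0
    have h1 := seminorm_le_add_mul_norm_sub (fun x => (hpk x).2) (indic u) g
    have h2 := mul_le_mul_of_nonneg_left hnorm hC.le
    rw [mul_assoc]
    linarith
  have hT := (tendsto_one_div_add_atTop_nhds_zero_nat (𝕜 := ℝ)).const_mul (C * (c / k + 1))
  have := ge_of_tendsto' (tendsto_const_nhds.add hT) hbound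
  rw [mul_zero, add_zero] at this
  linarith

/-- The indicators of two such bad points are both minimisers for s, and so is their mean; strict
convexity makes them equal. -/
theorem subsingleton_isBadPoint_headInf {p : Seminorm ℝ C₀(Υ, ℝ)} (hp : IsEquivalentNorm p)
    (hsc : IsStrictlyConvexNorm p) (s : Υ) :
    {u : Υ | IsBadPoint (headInf p) u ∧ s ≤ u ∧ headInf p u = headInf p s}.Subsingleton := by
  rintro u ⟨hu, hsu, hus⟩ v ⟨hv, hsv, hvs⟩
  have heq : indic u = indic v := hsc.eq_of_half_add (c := headInf p s)
    (hus ▸ le_headInf_of_isBadPoint hp hu) (hvs ▸ le_headInf_of_isBadPoint hp hv)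
    (headInf_le (half_add_mem_headSet (headSet_mono hsu (indic_mem_headSet u))
      (headSet_mono hsv (indic_mem_headSet v))))
  have key : ∀ x y : Υ, indic x = indic y → x ≤ y := fun x y h => by
    by_contra hxy
    have h1 := indic_of_le (le_refl x)
    rw [h, indic_of_not_le hxy] at h1
    exact zero_ne_one h1
  exact le_antisymm (key _ _ heq) (key _ _ heq.symm)

end Phi

/-! ### Norms built from suprema of Hilbertian seminorms; Day's renorming -/

section Renorming

variable {X : Type*} [NormedAddCommGroup X] [NormedSpace ℝ X]

theorem exists_seminorm_sq_hasSum (σ : ℕ → Seminorm ℝ X)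
    (hσ : ∀ n x, σ n x ≤ (1 / 2) ^ n * ‖x‖) :
    ∃ P : Seminorm ℝ X, ∀ x, HasSum (fun n => σ n x ^ 2) (P x ^ 2) := by
  have hsum : ∀ x, Summable fun n => σ n x ^ 2 := fun x => by
    refine Summable.of_nonneg_of_le (fun n => sq_nonneg _)
      (fun n => pow_le_pow_left₀ (apply_nonneg _ _) (hσ n x) 2) ?_
    have : Summable fun n : ℕ => (1 / 4 : ℝ) ^ n * ‖x‖ ^ 2 :=
      (summable_geometric_of_lt_one (by norm_num) (by norm_num)).mul_right _
    refine this.congr fun n => ?_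
    rw [mul_pow, ← pow_mul, mul_comm n 2, pow_mul]
    norm_num
  have hadd : ∀ x y, √(∑' n, σ n (x + y) ^ 2) ≤ √(∑' n, σ n x ^ 2) + √(∑' n, σ n y ^ 2) := by
    intro x y
    have h := Real.Lp_add_le_tsum_of_nonneg (p := 2) (f := fun n => σ n x) (g := fun n => σ n y)
      one_le_two (fun n => apply_nonneg _ _) (fun n => apply_nonneg _ _)
      (by simpa using hsum x) (by simpa using hsum y)
    simp only [Real.rpow_two, ← Real.sqrt_eq_rpow] at h
    refine le_trans (Real.sqrt_le_sqrt ?_) h.2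
    exact (hsum _).tsum_le_tsum (fun n => pow_le_pow_left₀ (apply_nonneg _ _)
      (map_add_le_add _ _ _) 2) h.1
  refine ⟨Seminorm.of (fun x => √(∑' n, σ n x ^ 2)) hadd fun a x => ?_, fun x => ?_⟩
  · simp only [map_smul_eq_mul, mul_pow, tsum_mul_left]
    rw [Real.sqrt_mul (sq_nonneg _), Real.sqrt_sq (norm_nonneg _)]
  · have : (√(∑' n, σ n x ^ 2)) ^ 2 = ∑' n, σ n x ^ 2 :=
      Real.sq_sqrt (tsum_nonneg fun n => sq_nonneg _)
    change HasSum _ ((√(∑' n, σ n x ^ 2)) ^ 2)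
    rw [this]
    exact (hsum x).hasSum

/-- Convexity of q². It makes every term of the flatness defect of a sum of squares nonnegative, so
the whole defect controls each term. -/
theorem Seminorm.two_mul_sq_le (q : Seminorm ℝ X) (x h : X) :
    2 * q x ^ 2 ≤ q (x + h) ^ 2 + q (x - h) ^ 2 := by
  have h1 : 2 * q x ≤ q (x + h) + q (x - h) := by
    have := map_add_le_add q (x + h) (x - h)
    rwa [show x + h + (x - h) = (2 : ℝ) • x by rw [two_smul]; abel, map_smul_eq_mul,
      Real.norm_of_nonneg zero_le_two] at this
  nlinarith [apply_nonneg q x, sq_nonneg (q (x + h) - q (x - h))]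

/-- Given countably many families of seminorms satisfying the parallelogram law, there is an
equivalent norm for which almost flat perturbations of `x` are small with respect to every member
of a family that almost attains the supremum of the family at `x`. -/
theorem exists_equivalentNorm_of_families {κ : Type*} [Countable κ] [Nonempty κ] {α : κ → Type*}
    (q : ∀ k, α k → Seminorm ℝ X) (C : κ → ℝ) (hC0 : ∀ k, 0 ≤ C k)
    (hC : ∀ k a x, q k a x ≤ C k * ‖x‖)
    (hq : ∀ k a x h, q k a (x + h) ^ 2 + q k a (x - h) ^ 2 = 2 * q k a x ^ 2 + 2 * q k a h ^ 2) :
    ∃ p : Seminorm ℝ X, IsEquivalentNorm p ∧ ∀ (x : X) (h : ℕ → X),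
      Tendsto (fun n => p (x + h n) ^ 2 + p (x - h n) ^ 2 - 2 * p x ^ 2) atTop (𝓝 0) →
      ∀ (k : κ) (B : ℝ), (∀ a, q k a x ^ 2 ≤ B) → ∀ ε > 0, ∀ᶠ n in atTop, ∀ a,
        q k a (h n) ^ 2 ≤ B - q k a x ^ 2 + ε := by
  obtain ⟨e, he⟩ := exists_surjective_nat κ
  let S : κ → Seminorm ℝ X := fun k => ⨆ a, q k a
  have hbdd : ∀ k, BddAbove (range (q k)) := fun k =>
    Seminorm.bddAbove_range_iff.2 fun x => ⟨C k * ‖x‖, by rintro _ ⟨a, rfl⟩; exact hC k a x⟩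
  have hS : ∀ k x, S k x = ⨆ a, q k a x := fun k x => Seminorm.iSup_apply (hbdd k)
  have hqS : ∀ k a x, q k a x ≤ S k x := fun k a x => by
    rw [hS]
    exact le_ciSup (f := fun a => q k a x) (Seminorm.bddAbove_range_iff.1 (hbdd k) x) a
  have hSC : ∀ k x, S k x ≤ C k * ‖x‖ := fun k x => by
    rw [hS]
    exact Real.iSup_le (fun a => hC k a x) (mul_nonneg (hC0 k) (norm_nonneg _))
  have hSB : ∀ k x B, (∀ a, q k a x ^ 2 ≤ B) → 0 ≤ B → S k x ^ 2 ≤ B := fun k x B hB hB0 => by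
    rw [← Real.le_sqrt (apply_nonneg _ _) hB0, hS]
    exact Real.iSup_le (fun a => Real.le_sqrt_of_sq_le (hB a)) (Real.sqrt_nonneg _)
  have hpos : ∀ n, 0 < (1 / 2 : ℝ) ^ (n + 1) / (1 + C (e n)) := fun n => by
    have := hC0 (e n)
    positivity
  let d : ℕ → NNReal := fun n => ⟨(1 / 2) ^ (n + 1) / (1 + C (e n)), (hpos n).le⟩
  -- The zeroth term supplies the lower bound of the equivalent norm; the weights `d` make term n at
  -- most 2⁻ⁿ times the norm.
  let σ : ℕ → Seminorm ℝ X := fun n => Nat.casesOn n (normSeminorm ℝ X) fun m => d m • S (e m)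
  have hσ0 : ∀ x, σ 0 x = ‖x‖ := fun x => rfl
  have hσS : ∀ m x, σ (m + 1) x = (1 / 2) ^ (m + 1) / (1 + C (e m)) * S (e m) x := fun m x => rfl
  have hσ : ∀ n x, σ n x ≤ (1 / 2) ^ n * ‖x‖ := by
    rintro (_ | m) x
    · simp [hσ0]
    · rw [hσS, div_mul_eq_mul_div, mul_div_assoc]
      refine mul_le_mul_of_nonneg_left ?_ (by positivity)
      rw [div_le_iff₀ (by linarith [hC0 (e m)])]
      nlinarith [hSC (e m) x, norm_nonneg x]
  obtain ⟨p, hp⟩ := exists_seminorm_sq_hasSum σ hσ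
  refine ⟨p, ⟨1, 2, one_pos, two_pos, fun x => ⟨?_, ?_⟩⟩, ?_⟩
  · have := le_hasSum (hp x) 0 fun j _ => sq_nonneg _
    rw [hσ0] at this
    rw [one_mul]
    exact (pow_le_pow_iff_left₀ (norm_nonneg x) (apply_nonneg p x) two_ne_zero).1 this
  · have h4 : HasSum (fun n : ℕ => (1 / 4 : ℝ) ^ n * ‖x‖ ^ 2) ((1 - 1 / 4)⁻¹ * ‖x‖ ^ 2) :=
      (hasSum_geometric_of_lt_one (by norm_num) (by norm_num)).mul_right _
    have := hasSum_le (fun n => ?_) (hp x) h4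
    · refine (pow_le_pow_iff_left₀ (apply_nonneg p x) (by positivity) two_ne_zero).1
        (this.trans ?_)
      nlinarith [sq_nonneg ‖x‖]
    · refine (pow_le_pow_left₀ (apply_nonneg _ _) (hσ n x) 2).trans (le_of_eq ?_)
      rw [mul_pow, ← pow_mul, mul_comm n 2, pow_mul]
      norm_num
  · intro x h hlim k B hB ε hε
    obtain ⟨m, rfl⟩ := he k
    have hd := hpos m
    set δ := (1 / 2 : ℝ) ^ (m + 1) / (1 + C (e m)) with hδ
    have hev := (hlim.eventually (gt_mem_nhds (show 0 < δ ^ 2 * (2 * ε) by positivity)))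
    filter_upwards [hev] with n hn a
    have hsum := (((hp (x + h n)).add (hp (x - h n))).sub ((hp x).mul_left 2))
    have h1 := le_hasSum hsum (m + 1) fun j _ => by
      linarith [Seminorm.two_mul_sq_le (σ j) x (h n)]
    have h2 : δ ^ 2 * (S (e m) (x + h n) ^ 2 + S (e m) (x - h n) ^ 2 - 2 * S (e m) x ^ 2)
        < δ ^ 2 * (2 * ε) := by
      refine lt_of_le_of_lt (le_of_eq_of_le ?_ h1) hn
      simp only [hσS]
      ring
    have h3 := lt_of_mul_lt_mul_left h2 (by positivity)
    have h4 := hSB (e m) x B hB ((sq_nonneg _).trans (hB a))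
    -- The supremum dominates `q` at x ± h and has square at most B at x; the parallelogram law
    -- turns its small defect into a bound on `q` at h.
    have h5 := pow_le_pow_left₀ (apply_nonneg _ _) (hqS (e m) a (x + h n)) 2
    have h6 := pow_le_pow_left₀ (apply_nonneg _ _) (hqS (e m) a (x - h n)) 2
    have h7 := hq (e m) a x (h n)
    linarith

/-- The seminorm whose square is the sum of the squares of finitely many functionals. -/
noncomputable def sumSqSeminorm {ι : Type*} [Fintype ι] (φ : ι → X →L[ℝ] ℝ) : Seminorm ℝ X :=
  (normSeminorm ℝ (EuclideanSpace ℝ ι)).comp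
    ((WithLp.linearEquiv 2 ℝ (ι → ℝ)).symm.toLinearMap ∘ₗ
      LinearMap.pi fun i => (φ i : X →ₗ[ℝ] ℝ))

theorem sumSqSeminorm_sq {ι : Type*} [Fintype ι] (φ : ι → X →L[ℝ] ℝ) (x : X) :
    sumSqSeminorm φ x ^ 2 = ∑ i, φ i x ^ 2 := by
  simp [sumSqSeminorm, EuclideanSpace.norm_sq_eq]

theorem sumSqSeminorm_parallelogram {ι : Type*} [Fintype ι] (φ : ι → X →L[ℝ] ℝ) (x h : X) :
    sumSqSeminorm φ (x + h) ^ 2 + sumSqSeminorm φ (x - h) ^ 2 =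
      2 * sumSqSeminorm φ x ^ 2 + 2 * sumSqSeminorm φ h ^ 2 := by
  simp only [sumSqSeminorm_sq, Finset.mul_sum, ← Finset.sum_add_distrib, map_add, map_sub]
  exact Finset.sum_congr rfl fun i _ => by ring

theorem sumSqSeminorm_le {ι : Type*} [Fintype ι] (φ : ι → X →L[ℝ] ℝ) {c : ℝ} (hc : 0 ≤ c)
    (hφ : ∀ i x, |φ i x| ≤ c * ‖x‖) {N : ℕ} (hN : Fintype.card ι ≤ N) (x : X) :
    sumSqSeminorm φ x ≤ (N + 1) * c * ‖x‖ := by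
  refine (pow_le_pow_iff_left₀ (apply_nonneg _ x) (by positivity) two_ne_zero).1 ?_
  rw [sumSqSeminorm_sq]
  have h1 : ∑ i, φ i x ^ 2 ≤ ∑ _i : ι, (c * ‖x‖) ^ 2 :=
    Finset.sum_le_sum fun i _ => sq_le_sq' (by linarith [abs_le.1 (hφ i x)]) (abs_le.1 (hφ i x)).2
  have h2 : (Fintype.card ι : ℝ) ≤ N := by exact_mod_cast hN
  rw [Finset.sum_const, Finset.card_univ, nsmul_eq_mul] at h1
  have h3 : (0 : ℝ) ≤ (c * ‖x‖) ^ 2 := sq_nonneg _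
  have h4 : (0 : ℝ) ≤ N := Nat.cast_nonneg N
  calc _ ≤ _ := h1
    _ ≤ N * (c * ‖x‖) ^ 2 := mul_le_mul_of_nonneg_right h2 h3
    _ ≤ (N + 1) ^ 2 * (c * ‖x‖) ^ 2 := mul_le_mul_of_nonneg_right (by nlinarith) h3
    _ = _ := by ring

/-- Apply flatness at the midpoint m = (x + y)/2 with d = (x - y)/2. -/
theorem isStrictlyConvexNorm_of_flat {p : Seminorm ℝ X}
    (H : ∀ m d, p (m + d) ^ 2 + p (m - d) ^ 2 - 2 * p m ^ 2 = 0 → d = 0) :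
    IsStrictlyConvexNorm p := by
  intro x y hxy hy
  have h1 : (1 / 2 : ℝ) • (x + y) + (1 / 2 : ℝ) • (x - y) = x := by module
  have h2 : (1 / 2 : ℝ) • (x + y) - (1 / 2 : ℝ) • (x - y) = y := by module
  have hm : p ((1 / 2 : ℝ) • (x + y)) = p y := by
    rw [hy, map_smul_eq_mul, Real.norm_of_nonneg (by norm_num)]
  have := H ((1 / 2 : ℝ) • (x + y)) ((1 / 2 : ℝ) • (x - y)) (by rw [h1, h2, hm, hxy]; ring)
  exact sub_eq_zero.1 ((smul_eq_zero.1 this).resolve_left (by norm_num))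

theorem IsMLURNorm.isStrictlyConvexNorm {p : Seminorm ℝ X} (hp : IsEquivalentNorm p)
    (h : IsMLURNorm p) : IsStrictlyConvexNorm p := by
  obtain ⟨c, C, hc, -, hpc⟩ := hp
  refine isStrictlyConvexNorm_of_flat fun m d hmd => ?_
  have := h m (fun _ => d) (by simp only [hmd]; exact tendsto_const_nhds)
  have hd : p d = 0 := tendsto_nhds_unique tendsto_const_nhds this
  exact norm_eq_zero.1 (by nlinarith [(hpc d).1, norm_nonneg d])

/-- Exchange argument: terms of `B` outside `A` are at most η² and terms of `A` outside `B` at least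
η², while `B` has at most d surplus elements. -/
theorem sum_sq_le_of_card_le {ι : Type*} [DecidableEq ι] {u : ι → ℝ} {A B : Finset ι} {η : ℝ}
    {d : ℕ} (hA : ∀ i ∈ A, η ^ 2 ≤ u i ^ 2) (hB : ∀ i ∉ A, u i ^ 2 ≤ η ^ 2)
    (hcard : B.card ≤ A.card + d) : ∑ i ∈ B, u i ^ 2 ≤ ∑ i ∈ A, u i ^ 2 + d * η ^ 2 := by
  have h1 : ∑ i ∈ B, u i ^ 2 = ∑ i ∈ B ∩ A, u i ^ 2 + ∑ i ∈ B \ A, u i ^ 2 :=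
    (Finset.sum_inter_add_sum_sdiff B A _).symm
  have h2 : ∑ i ∈ A, u i ^ 2 = ∑ i ∈ A ∩ B, u i ^ 2 + ∑ i ∈ A \ B, u i ^ 2 :=
    (Finset.sum_inter_add_sum_sdiff A B _).symm
  have h3 : ∑ i ∈ B \ A, u i ^ 2 ≤ (B \ A).card * η ^ 2 := by
    rw [← nsmul_eq_mul]
    exact Finset.sum_le_card_nsmul _ _ _ fun i hi => hB i (Finset.mem_sdiff.1 hi).2
  have h4 : (A \ B).card * η ^ 2 ≤ ∑ i ∈ A \ B, u i ^ 2 := by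
    rw [← nsmul_eq_mul]
    exact Finset.card_nsmul_le_sum _ _ _ fun i hi => hA i (Finset.mem_sdiff.1 hi).1
  have h5 : ((B \ A).card : ℝ) ≤ (A \ B).card + d := by
    have e1 := Finset.card_sdiff_add_card_inter B A
    have e2 := Finset.card_sdiff_add_card_inter A B
    rw [Finset.inter_comm] at e2
    exact_mod_cast (by omega : (B \ A).card ≤ (A \ B).card + d)
  rw [h1, h2, Finset.inter_comm]
  nlinarith [sq_nonneg η]

theorem finite_setOf_le_abs {I : Type*} [TopologicalSpace I] [DiscreteTopology I] (u : C₀(I, ℝ))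
    {ε : ℝ} (hε : 0 < ε) : {i | ε ≤ |u i|}.Finite := by
  have h := u.zero_at_infty' (Metric.ball_mem_nhds (0 : ℝ) hε)
  rw [cocompact_eq_cofinite] at h
  refine (mem_cofinite.1 h).subset fun i (hi : ε ≤ |u i|) hmem => ?_
  have : |u i| < ε := by simpa using hmem
  exact absurd hi (not_le_of_gt this)

/-- A space which maps injectively into `c₀(I)` has an equivalent strictly convex norm. -/
theorem exists_strictlyConvexNorm_of_injective {I : Type*} [TopologicalSpace I]
    [DiscreteTopology I] (T : X →L[ℝ] C₀(I, ℝ)) (hT : Function.Injective T) :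
    ∃ p : Seminorm ℝ X, IsEquivalentNorm p ∧ IsStrictlyConvexNorm p := by
  classical
  obtain ⟨p, hp, h⟩ := exists_equivalentNorm_of_families (X := X) (κ := ℕ)
    (α := fun n => {A : Finset I // A.card = n})
    (fun _ A => sumSqSeminorm fun i : A.1 => evalCLM (i : I) ∘L T)
    (fun n => (n + 1) * ‖T‖) (fun n => by positivity)
    (fun n A x => sumSqSeminorm_le _ (norm_nonneg T)
      (fun i x => (abs_apply_le_norm _ _).trans (T.le_opNorm x)) (by simp [A.2]) x)
    fun _ _ x h => sumSqSeminorm_parallelogram _ x h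
  refine ⟨p, hp, isStrictlyConvexNorm_of_flat fun m d hmd => hT ?_⟩
  have key := h m (fun _ => d) (by simp only [hmd]; exact tendsto_const_nhds)
  have hq : ∀ (A : Finset I) (B : ℝ),
      (∀ A' : Finset I, A'.card = A.card → ∑ i ∈ A', T m i ^ 2 ≤ B) →
      ∑ i ∈ A, T d i ^ 2 ≤ B - ∑ i ∈ A, T m i ^ 2 := by
    intro A B hB
    refine le_of_forall_pos_le_add fun ε hε => ?_
    have e : ∀ (A' : Finset I) (z : X),
        ∑ i : A', (evalCLM (i : I) ∘L T) z ^ 2 = ∑ i ∈ A', T z i ^ 2 := fun A' z =>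
      Finset.sum_coe_sort A' fun i => T z i ^ 2
    have := key A.card B (fun A' => by rw [sumSqSeminorm_sq, e]; exact hB _ A'.2) ε hε
    obtain ⟨_, hn⟩ := this.exists
    have := hn ⟨A, rfl⟩
    rwa [sumSqSeminorm_sq, sumSqSeminorm_sq, e, e] at this
  rw [map_zero]
  ext j
  by_contra hj
  change ¬ T d j = 0 at hj
  -- Halving makes ε² strictly smaller than (T d j)². The set A of coordinates of T m of size at
  -- least ε is optimal among sets of its cardinality.
  set ε := |T d j| / 2
  have hε : 0 < ε := half_pos (abs_pos.2 hj)
  set A := (finite_setOf_le_abs (T m) hε).toFinset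
  have hAm : ∀ i ∈ A, ε ^ 2 ≤ T m i ^ 2 := fun i hi => by
    have : ε ≤ |T m i| := by simpa [A] using hi
    rw [← sq_abs (T m i)]
    exact pow_le_pow_left₀ hε.le this 2
  have hAc : ∀ i ∉ A, T m i ^ 2 ≤ ε ^ 2 := fun i hi => by
    have : |T m i| < ε := by simpa [A] using hi
    rw [← sq_abs (T m i)]
    exact pow_le_pow_left₀ (abs_nonneg _) this.le 2
  have hlt : ε ^ 2 < T d j ^ 2 := by
    rw [← sq_abs (T d j)]
    exact pow_lt_pow_left₀ (half_lt_self (abs_pos.2 hj)) hε.le two_ne_zero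
  by_cases hjA : j ∈ A
  · have h1 := hq A _ fun A' hA' => sum_sq_le_of_card_le (d := 0) hAm hAc (by omega)
    have h2 := Finset.single_le_sum (f := fun i => T d i ^ 2) (fun i _ => sq_nonneg _) hjA
    simp only [Nat.cast_zero, zero_mul, add_zero, sub_self] at h1 h2
    nlinarith
  -- Adding j to A misses the optimum for cardinality |A| + 1 by at most ε², which would bound (T d
  -- j)² by ε².
  · have h1 := hq (insert j A) _ fun A' hA' => sum_sq_le_of_card_le (d := 1) hAm hAc
      (by rw [hA', Finset.card_insert_of_notMem hjA])
    have h2 := Finset.single_le_sum (f := fun i => T d i ^ 2) (fun i _ => sq_nonneg _)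
      (Finset.mem_insert_self j A)
    rw [Finset.sum_insert (f := fun i => T m i ^ 2) hjA] at h1
    simp only [Nat.cast_one, one_mul] at h1 h2
    nlinarith [sq_nonneg (T m j)]

end Renorming

/-! ### Left continuous potentials, level successors and gaps -/

section Potential

variable {Υ : Type u} [PartialOrder Υ]

/-- An increasing function which is constant on no nonempty ever-branching set, has at most one bad
point on each level component, and is left continuous at limit points. -/
structure IsRegularPotential (ρ : Υ → ℝ) : Prop where
  mono : Monotone ρ
  exists_lt : ∀ w, Order.IsSuccLimit w → ∀ a < ρ w, ∃ x < w, a < ρ x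
  not_const : ∀ Γ : Set Υ, Γ.Nonempty → IsEverBranching Γ → ¬ ∃ c : ℝ, ∀ t ∈ Γ, ρ t = c
  bad_subsingleton : ∀ s : Υ, {u : Υ | IsBadPoint ρ u ∧ s ≤ u ∧ ρ u = ρ s}.Subsingleton

theorem IsEverBranching.exists_incomparable {Γ : Set Υ} (h : IsEverBranching Γ) {t : Υ}
    (ht : t ∈ Γ) : ∃ a ∈ Γ, ∃ b ∈ Γ, t < a ∧ t < b ∧ ¬ a ≤ b ∧ ¬ b ≤ a := by
  have := h t ht
  simp only [IsChain, Set.Pairwise, not_forall] at this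
  obtain ⟨x, hx, y, hy, -, h⟩ := this
  push Not at h
  refine ⟨x, hx.1, y, hy.1, lt_of_le_of_ne hx.2 ?_, lt_of_le_of_ne hy.2 ?_, h.1, h.2⟩
  · rintro rfl
    exact h.1 hy.2
  · rintro rfl
    exact h.2 hx.2

open Classical in
/-- The modification of `ρ` which is left continuous at limit points. -/
noncomputable def leftLimit (ρ : Υ → ℝ) (t : Υ) : ℝ :=
  if Order.IsSuccLimit t then sSup (ρ '' Iio t) else ρ t

theorem leftLimit_of_not_limit {ρ : Υ → ℝ} {t : Υ} (h : ¬ Order.IsSuccLimit t) :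
    leftLimit ρ t = ρ t := if_neg h

theorem le_leftLimit_of_lt {ρ : Υ → ℝ} (hρ : Monotone ρ) {s t : Υ} (h : s < t) :
    ρ s ≤ leftLimit ρ t := by
  by_cases ht : Order.IsSuccLimit t
  · rw [leftLimit, if_pos ht]
    exact le_csSup ⟨ρ t, by rintro _ ⟨x, hx, rfl⟩; exact hρ (le_of_lt hx)⟩ ⟨s, h, rfl⟩
  · rw [leftLimit_of_not_limit ht]
    exact hρ h.le

theorem leftLimit_le {ρ : Υ → ℝ} (hρ : Monotone ρ) (t : Υ) : leftLimit ρ t ≤ ρ t := by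
  by_cases ht : Order.IsSuccLimit t
  · rw [leftLimit, if_pos ht]
    obtain ⟨x, hx⟩ := IsSuccLimit.exists_lt ht
    exact csSup_le ⟨_, x, hx, rfl⟩ (by rintro _ ⟨x, hx, rfl⟩; exact hρ (le_of_lt hx))
  · exact (leftLimit_of_not_limit ht).le

theorem leftLimit_mono {ρ : Υ → ℝ} (hρ : Monotone ρ) : Monotone (leftLimit ρ) := by
  intro s t h
  rcases eq_or_lt_of_le h with rfl | h
  · exact le_rfl
  · exact (leftLimit_le hρ s).trans (le_leftLimit_of_lt hρ h)

/-- Immediate successors are not limits, so their values do not change. If the value at t drops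
strictly, the drop is a gap below all successors, and t is good with F empty. -/
theorem isBadPoint_of_leftLimit {ρ : Υ → ℝ} (hρ : Monotone ρ) {t : Υ}
    (h : IsBadPoint (leftLimit ρ) t) : IsBadPoint ρ t ∧ leftLimit ρ t = ρ t := by
  have hsucc : ∀ u ∈ immSucc t, leftLimit ρ u = ρ u := fun u hu =>
    leftLimit_of_not_limit (CovBy.not_isSuccLimit hu)
  constructor
  · rintro ⟨F, hF, hFt, δ, hδ, hgap⟩
    refine h ⟨F, hF, hFt, δ, hδ, fun u hu => ?_⟩
    rw [hsucc u hu.1]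
    linarith [hgap u hu, leftLimit_le hρ t]
  · by_contra hne
    have hlt := lt_of_le_of_ne (leftLimit_le hρ t) hne
    refine h ⟨∅, finite_empty, empty_subset _, ρ t - leftLimit ρ t, sub_pos.2 hlt,
      fun u hu => ?_⟩
    rw [hsucc u hu.1]
    linarith [hρ (CovBy.le hu.1)]

theorem isRegularPotential_leftLimit [IsTree Υ] {ρ : Υ → ℝ} (hρ : Monotone ρ)
    (hΓ : ∀ Γ : Set Υ, Γ.Nonempty → IsEverBranching Γ → ¬ ∃ c : ℝ, ∀ t ∈ Γ, ρ t = c)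
    (hbad : ∀ s : Υ, {u : Υ | IsBadPoint ρ u ∧ s ≤ u ∧ ρ u = ρ s}.Subsingleton) :
    IsRegularPotential (leftLimit ρ) where
  mono := leftLimit_mono hρ
  exists_lt := by
    intro w hw a ha
    rw [leftLimit, if_pos hw] at ha
    obtain ⟨x, hx⟩ := IsSuccLimit.exists_lt hw
    obtain ⟨_, ⟨y, hy, rfl⟩, hay⟩ := exists_lt_of_lt_csSup (s := ρ '' Iio w) ⟨_, x, hx, rfl⟩ ha
    obtain ⟨z, hz, hzw⟩ := IsSuccLimit.exists_between' hw hy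
    exact ⟨z, hzw, hay.trans_le (le_leftLimit_of_lt hρ hz)⟩
  bad_subsingleton := by
    rintro s u ⟨hu, hsu, hus⟩ v ⟨hv, hsv, hvs⟩
    obtain ⟨hu', hu2⟩ := isBadPoint_of_leftLimit hρ hu
    obtain ⟨hv', hv2⟩ := isBadPoint_of_leftLimit hρ hv
    have hle := leftLimit_le hρ s
    have h1 := hρ hsu
    have h2 := hρ hsv
    exact hbad s ⟨hu', hsu, by linarith⟩ ⟨hv', hsv, by linarith⟩
  not_const := by
    rintro Γ ⟨t, ht⟩ hbr ⟨c, hc⟩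
    -- The two functions agree at non-limit points. Those lying between points of Γ again form an
    -- ever-branching set, because successors towards later points of Γ are available above each of
    -- two incomparable points.
    refine hΓ {x | ¬ Order.IsSuccLimit x ∧ (∃ s ∈ Γ, s < x) ∧ ∃ t ∈ Γ, x ≤ t} ?_ ?_ ⟨c, ?_⟩
    · obtain ⟨a, ha, -, -, hta, -⟩ := hbr.exists_incomparable ht
      obtain ⟨v, hv, hva⟩ := exists_covBy_le hta
      exact ⟨v, CovBy.not_isSuccLimit hv, ⟨t, ht, hv.lt⟩, a, ha, hva⟩
    · rintro x ⟨-, -, s, hs, hxs⟩ hchain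
      obtain ⟨a, ha, b, hb, hsa, hsb, hab, hba⟩ := hbr.exists_incomparable hs
      have key : ∀ a ∈ Γ, s < a → ∃ v, a < v ∧ v ∈ {x | ¬ Order.IsSuccLimit x ∧
          (∃ s ∈ Γ, s < x) ∧ ∃ t ∈ Γ, x ≤ t} ∩ Ici x := by
        intro a ha hsa
        obtain ⟨a', ha', -, -, haa', -⟩ := hbr.exists_incomparable ha
        obtain ⟨v, hv, hva⟩ := exists_covBy_le haa'
        exact ⟨v, hv.lt, ⟨CovBy.not_isSuccLimit hv, ⟨a, ha, hv.lt⟩, a', ha', hva⟩,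
          hxs.trans (hsa.trans hv.lt).le⟩
      obtain ⟨v, hav, hv⟩ := key a ha hsa
      obtain ⟨w, hbw, hw⟩ := key b hb hsb
      rcases hchain.total hv hw with h | h
      · exact (le_or_le_of_le (hav.le.trans h) hbw.le).elim hab hba
      · exact (le_or_le_of_le hav.le (hbw.le.trans h)).elim hab hba
    · rintro x ⟨hx, ⟨s, hs, hsx⟩, t, ht, hxt⟩
      rw [← leftLimit_of_not_limit (ρ := ρ) hx]
      exact le_antisymm ((leftLimit_mono hρ hxt).trans (hc t ht).le)
        ((hc s hs).ge.trans (leftLimit_mono hρ hsx.le))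

/-- The immediate successors of `s` on the same level of `ρ`. -/
def levelSucc (ρ : Υ → ℝ) (s : Υ) : Set Υ := {v | s ⋖ v ∧ ρ v = ρ s}

theorem IsGoodPoint.finite_levelSucc {ρ : Υ → ℝ} {s : Υ} (h : IsGoodPoint ρ s) :
    (levelSucc ρ s).Finite := by
  obtain ⟨F, hF, -, δ, hδ, hgap⟩ := h
  refine hF.subset fun v hv => ?_
  by_contra hvF
  linarith [hgap v ⟨hv.1, hvF⟩, hv.2]

/-- Outside F the gap is uniform, and the finitely many exceptional successors off the level have a
least value, still above ρ(s). -/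
theorem IsGoodPoint.exists_gap {ρ : Υ → ℝ} (hρ : Monotone ρ) {s : Υ} (h : IsGoodPoint ρ s) :
    ∃ q : ℚ, ρ s < q ∧ ∀ v, s ⋖ v → ρ v ≠ ρ s → q ≤ ρ v := by
  obtain ⟨F, hF, -, δ, hδ, hgap⟩ := h
  have hfin : ∃ c, ρ s < c ∧ ∀ v ∈ F ∩ {v | s ⋖ v ∧ ρ v ≠ ρ s}, c ≤ ρ v := by
    rcases (F ∩ {v | s ⋖ v ∧ ρ v ≠ ρ s}).eq_empty_or_nonempty with he | hne
    · exact ⟨ρ s + 1, by linarith, by simp [he]⟩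
    · obtain ⟨m, hm, hmin⟩ := exists_min_image _ ρ (hF.inter_of_left _) hne
      exact ⟨ρ m, lt_of_le_of_ne (hρ hm.2.1.le) hm.2.2.symm, hmin⟩
  obtain ⟨c, hc, hcF⟩ := hfin
  obtain ⟨q, hq, hqc⟩ := exists_rat_btwn (show ρ s < min c (ρ s + δ) from
    lt_min hc (by linarith))
  refine ⟨q, hq, fun v hv hne => ?_⟩
  by_cases hvF : v ∈ F
  · exact hqc.le.trans ((min_le_left _ _).trans (hcF v ⟨hvF, hv, hne⟩))
  · exact hqc.le.trans ((min_le_right _ _).trans (hgap v ⟨hv, hvF⟩))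

/-- A root is a point, not a limit, at which `ρ` jumps. -/
def IsRoot (ρ : Υ → ℝ) (r : Υ) : Prop := ¬ Order.IsSuccLimit r ∧ ∀ x < r, ρ x < ρ r

theorem IsRoot.exists_gap [IsTree Υ] {ρ : Υ → ℝ} (hρ : Monotone ρ) {r : Υ} (h : IsRoot ρ r) :
    ∃ q : ℚ, (∀ x < r, ρ x < q) ∧ (q : ℝ) ≤ ρ r := by
  rcases exists_covBy_of_not_isSuccLimit h.1 with hmin | ⟨x, hx⟩
  · obtain ⟨q, -, hq⟩ := exists_rat_btwn (show ρ r - 1 < ρ r by linarith)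
    exact ⟨q, fun x hx => absurd hx (hmin x), hq.le⟩
  · obtain ⟨q, hxq, hq⟩ := exists_rat_btwn (h.2 x hx.lt)
    refine ⟨q, fun y hy => lt_of_le_of_lt (hρ ?_) hxq, hq.le⟩
    by_contra hyx
    exact hx.2 (lt_of_not_le_of_le hy.le hx.le hyx) hy

variable [TopologicalSpace Υ]

open Classical in
/-- The functional `f ↦ f s - ∑ f v`, the sum being over the immediate successors of `s` on the
same level of `ρ` (if there are finitely many). -/
noncomputable def drop (ρ : Υ → ℝ) (s : Υ) : C₀(Υ, ℝ) →L[ℝ] ℝ :=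
  evalCLM s - ∑ v ∈ if h : (levelSucc ρ s).Finite then h.toFinset else ∅, evalCLM v

theorem drop_eq {ρ : Υ → ℝ} {s : Υ} (h : (levelSucc ρ s).Finite) (f : C₀(Υ, ℝ)) :
    drop ρ s f = f s - ∑ v ∈ h.toFinset, f v := by
  simp [drop, h]

theorem exists_drop_bound (ρ : Υ → ℝ) (s : Υ) :
    ∃ b : ℝ, 0 < b ∧ b ≤ 1 ∧ ∀ f, b * |drop ρ s f| ≤ ‖f‖ := by
  refine ⟨1 / (1 + ‖drop ρ s‖), by positivity, ?_, fun f => ?_⟩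
  · rw [div_le_one (by positivity)]
    linarith [norm_nonneg (drop ρ s)]
  · rw [div_mul_eq_mul_div, one_mul, div_le_iff₀ (by positivity)]
    have := (drop ρ s).le_opNorm f
    rw [Real.norm_eq_abs] at this
    nlinarith [norm_nonneg f]

/-- At most one immediate successor of s lies in (0,t]. If it is on the level of s it cancels the
value 1 at s, so only s = t or a branch leaving the level at s contributes. -/
theorem drop_indic_ne_zero [IsHausdorffTree Υ] [IsTreeTopology Υ] {ρ : Υ → ℝ} {s t : Υ}
    (hs : (levelSucc ρ s).Finite) (h : drop ρ s (indic t) ≠ 0) :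
    s ≤ t ∧ (s = t ∨ ∃ v, s ⋖ v ∧ v ≤ t ∧ ρ v ≠ ρ s) ∧ |drop ρ s (indic t)| ≤ 1 := by
  rw [drop_eq hs] at *
  have hst : s ≤ t := by
    by_contra hst
    refine h ?_
    rw [indic_of_not_le hst, Finset.sum_eq_zero, sub_zero]
    intro v hv
    exact indic_of_not_le fun hvt => hst (((hs.mem_toFinset.1 hv).1.le).trans hvt)
  by_cases hv : ∃ v ∈ levelSucc ρ s, v ≤ t
  · obtain ⟨v, hv, hvt⟩ := hv
    refine absurd ?_ h
    rw [Finset.sum_eq_single_of_mem v (hs.mem_toFinset.2 hv), indic_of_le hst, indic_of_le hvt,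
      sub_self]
    intro w hw hne
    exact indic_of_not_le fun hwt =>
      hne (covBy_eq_of_le (hs.mem_toFinset.1 hw).1 hv.1 hwt hvt)
  · push Not at hv
    refine ⟨hst, ?_, ?_⟩
    · refine or_iff_not_imp_left.2 fun hne => ?_
      obtain ⟨v, hsv, hvt⟩ := exists_covBy_le (lt_of_le_of_ne hst hne)
      exact ⟨v, hsv, hvt, fun heq => hv v ⟨hsv, heq⟩ hvt⟩
    · rw [indic_of_le hst, Finset.sum_eq_zero, sub_zero, abs_one]
      exact fun v hvF => indic_of_not_le (hv v (hs.mem_toFinset.1 hvF))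

end Potential

/-! ### The coordinate operator into c₀ -/

section Operator

/-- The functions whose coordinates tend to 0 form a subspace, closed because the functionals are
uniformly bounded; it contains the indicators, hence everything. -/
theorem exists_operator_of_finite {Υ : Type*} [PartialOrder Υ] [TopologicalSpace Υ]
    [IsHausdorffTree Υ] [IsTreeTopology Υ] {I : Type*} [TopologicalSpace I] [DiscreteTopology I]
    (φ : I → C₀(Υ, ℝ) →L[ℝ] ℝ) (hφ : ∀ i f, |φ i f| ≤ ‖f‖)
    (hfin : ∀ t, ∀ ε > 0, {i | ε ≤ |φ i (indic t)|}.Finite) :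
    ∃ T : C₀(Υ, ℝ) →L[ℝ] C₀(I, ℝ), ∀ f i, T f i = φ i f := by
  let V : Submodule ℝ C₀(Υ, ℝ) :=
    { carrier := {f | Tendsto (fun i => φ i f) cofinite (𝓝 0)}
      zero_mem' := by simpa using tendsto_const_nhds
      add_mem' := fun {f g} hf hg => by
        simpa using Tendsto.add (M := ℝ) hf hg
      smul_mem' := fun c f hf => by
        simpa using Tendsto.const_mul c hf }
  have hiff : ∀ f, f ∈ V ↔ ∀ ε > 0, {i | ε ≤ |φ i f|}.Finite := fun f => by
    change Tendsto (fun i => φ i f) cofinite (𝓝 0) ↔ _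
    simp [Metric.tendsto_nhds, Filter.eventually_cofinite]
  have hV : IsClosed (V : Set C₀(Υ, ℝ)) := by
    refine isClosed_of_closure_subset fun f hf => (hiff f).2 fun ε hε => ?_
    obtain ⟨g, hg, hfg⟩ := Metric.mem_closure_iff.1 hf _ (half_pos hε)
    refine ((hiff g).1 hg _ (half_pos hε)).subset fun i (hi : ε ≤ |φ i f|) => ?_
    have h1 := hφ i (f - g)
    rw [dist_eq_norm] at hfg
    rw [map_sub] at h1
    change ε / 2 ≤ |φ i g|
    linarith [abs_sub_abs_le_abs_sub (φ i f) (φ i g)]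
  have hall : ∀ f, f ∈ V := mem_of_forall_indic_mem hV fun t => (hiff _).2 (hfin t)
  refine ⟨LinearMap.mkContinuous
    { toFun := fun f => ⟨⟨fun i => φ i f, continuous_of_discreteTopology⟩, by
        rw [cocompact_eq_cofinite]; exact hall f⟩
      map_add' := fun f g => by ext i; exact map_add (φ i) f g
      map_smul' := fun c f => by ext i; exact map_smul (φ i) c f } 1 fun f => ?_, fun f i => rfl⟩
  rw [one_mul]
  exact norm_le_of_forall_abs_le (norm_nonneg f) fun i => hφ i f

/-- The index set of the operator into `c₀`: a coordinate for each root and each good point. -/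
inductive Coord (Υ : Type u) : Type u
  | root : Υ → Coord Υ
  | node : Υ → Coord Υ

instance (Υ : Type u) : TopologicalSpace (Coord Υ) := ⊥

instance (Υ : Type u) : DiscreteTopology (Coord Υ) := ⟨rfl⟩

variable {Υ : Type u} [PartialOrder Υ] [TopologicalSpace Υ] [IsHausdorffTree Υ] [IsTreeTopology Υ]

/-- A summable-type weight on the rationals. -/
noncomputable def ratWeight (q : ℚ) : ℝ := 1 / ((Encodable.encode q : ℝ) + 1)

theorem ratWeight_pos (q : ℚ) : 0 < ratWeight q := by
  unfold ratWeight; positivity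

theorem ratWeight_le_one (q : ℚ) : ratWeight q ≤ 1 := by
  unfold ratWeight
  rw [div_le_one (by positivity)]
  linarith [(Nat.cast_nonneg (Encodable.encode q) : (0 : ℝ) ≤ _)]

theorem finite_setOf_le_ratWeight {ε : ℝ} (hε : 0 < ε) : {q | ε ≤ ratWeight q}.Finite := by
  obtain ⟨n, hn⟩ := exists_nat_gt (1 / ε)
  refine ((finite_Iio n).preimage Encodable.encode_injective.injOn).subset fun q hq => ?_
  have h1 : ε ≤ 1 / ((Encodable.encode q : ℝ) + 1) := hq
  rw [le_div_iff₀ (by positivity), mul_comm, ← le_div_iff₀ hε] at h1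
  have : (Encodable.encode q : ℝ) < n := by linarith
  exact_mod_cast this

open Classical in
/-- The operator into `c₀` given by the values at the roots and the drops at the good points. -/
theorem exists_coord_operator {ρ : Υ → ℝ} (hρ : Monotone ρ) :
    ∃ (T : C₀(Υ, ℝ) →L[ℝ] C₀(Coord Υ, ℝ)) (a b : Υ → ℝ), (∀ x, 0 < a x) ∧ (∀ x, 0 < b x) ∧
      (∀ f r, T f (.root r) = if IsRoot ρ r then a r * f r else 0) ∧
      ∀ f s, T f (.node s) = if IsGoodPoint ρ s then b s * drop ρ s f else 0 := by
  have hr : ∀ r, ∃ q : ℚ, IsRoot ρ r → (∀ x < r, ρ x < q) ∧ (q : ℝ) ≤ ρ r := fun r => by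
    by_cases h : IsRoot ρ r
    · obtain ⟨q, hq⟩ := h.exists_gap hρ
      exact ⟨q, fun _ => hq⟩
    · exact ⟨0, fun h' => absurd h' h⟩
  have hs : ∀ s, ∃ q : ℚ, IsGoodPoint ρ s → ρ s < q ∧ ∀ v, s ⋖ v → ρ v ≠ ρ s → q ≤ ρ v :=
    fun s => by
    by_cases h : IsGoodPoint ρ s
    · obtain ⟨q, hq⟩ := h.exists_gap hρ
      exact ⟨q, fun _ => hq⟩
    · exact ⟨0, fun h' => absurd h' h⟩
  choose qr hqr using hr
  choose qs hqs using hs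
  choose c hc hc1 hcb using exists_drop_bound (Υ := Υ) ρ
  let φ : Coord Υ → C₀(Υ, ℝ) →L[ℝ] ℝ := fun i => match i with
    | .root r => if IsRoot ρ r then ratWeight (qr r) • evalCLM r else 0
    | .node s => if IsGoodPoint ρ s then (ratWeight (qs s) * c s) • drop ρ s else 0
  have hφr : ∀ f r, φ (.root r) f = if IsRoot ρ r then ratWeight (qr r) * f r else 0 := by
    intro f r
    by_cases h : IsRoot ρ r <;> simp [φ, h]
  have hφs : ∀ f s, φ (.node s) f =
      if IsGoodPoint ρ s then ratWeight (qs s) * c s * drop ρ s f else 0 := by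
    intro f s
    by_cases h : IsGoodPoint ρ s <;> simp [φ, h]
  have hbound : ∀ i f, |φ i f| ≤ ‖f‖ := by
    rintro (r | s) f
    · rw [hφr]
      split_ifs
      · rw [abs_mul, abs_of_pos (ratWeight_pos _)]
        nlinarith [abs_apply_le_norm f r, ratWeight_le_one (qr r), ratWeight_pos (qr r),
          abs_nonneg (f r)]
      · simp
    · rw [hφs]
      split_ifs
      · rw [mul_assoc, abs_mul, abs_mul, abs_of_pos (ratWeight_pos _), abs_of_pos (hc s)]
        have h1 := hcb s f
        have h2 : 0 ≤ c s * |drop ρ s f| := mul_nonneg (hc s).le (abs_nonneg _)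
        nlinarith [ratWeight_le_one (qs s), ratWeight_pos (qs s)]
      · simp
  have hfin : ∀ t, ∀ ε > 0, {i | ε ≤ |φ i (indic t)|}.Finite := by
    intro t ε hε
    -- For roots r < r', ρ(r) lies below the rational of r' and not below that of r, so rationals of
    -- roots in (0,t] are distinct and only finitely many weights reach ε.
    have hfin1 : {r | IsRoot ρ r ∧ r ≤ t ∧ ε ≤ ratWeight (qr r)}.Finite := by
      refine Set.Finite.of_finite_image (f := qr) ((finite_setOf_le_ratWeight hε).subset ?_) ?_
      · rintro _ ⟨r, hr, rfl⟩
        exact hr.2.2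
      · have key : ∀ r r', IsRoot ρ r → IsRoot ρ r' → qr r = qr r' → ¬ r < r' := by
          intro r r' hr hr' hq hlt
          have h1 := (hqr r' hr').1 r hlt
          rw [← hq] at h1
          exact absurd (hqr r hr).2 (not_le_of_gt h1)
        rintro r ⟨hr, hrt, -⟩ r' ⟨hr', hrt', -⟩ hq
        by_contra hne
        rcases le_or_le_of_le hrt hrt' with h | h
        · exact key _ _ hr hr' hq (lt_of_le_of_ne h hne)
        · exact key _ _ hr' hr hq.symm (lt_of_le_of_ne h (Ne.symm hne))
    -- If s < s' ≤ t and s contributes, the branch leaves the level of s at once, so the rational of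
    -- s is at most ρ(s'), which is below the rational of s'.
    have hfin2 : {s | IsGoodPoint ρ s ∧ drop ρ s (indic t) ≠ 0 ∧ ε ≤ ratWeight (qs s)}.Finite := by
      refine Set.Finite.of_finite_image (f := qs) ((finite_setOf_le_ratWeight hε).subset ?_) ?_
      · rintro _ ⟨s, hs, rfl⟩
        exact hs.2.2
      · have key : ∀ s s', IsGoodPoint ρ s → IsGoodPoint ρ s' → drop ρ s (indic t) ≠ 0 →
            s' ≤ t → qs s = qs s' → ¬ s < s' := by
          intro s s' hs hs' hd hs't hq hlt
          obtain ⟨hst, h, -⟩ := drop_indic_ne_zero hs.finite_levelSucc hd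
          rcases h with rfl | ⟨v, hv, hvt, hne⟩
          · exact hlt.not_ge hs't
          · have hvs' : v ≤ s' := by
              by_contra hn
              exact hv.2 hlt (lt_of_not_le_of_le hvt hs't hn)
            have h1 := (hqs s hs).2 v hv hne
            have h2 := (hqs s' hs').1
            rw [← hq] at h2
            linarith [hρ hvs']
        rintro s ⟨hs, hd, -⟩ s' ⟨hs', hd', -⟩ hq
        have hst := (drop_indic_ne_zero hs.finite_levelSucc hd).1
        have hst' := (drop_indic_ne_zero hs'.finite_levelSucc hd').1
        by_contra hne
        rcases le_or_le_of_le hst hst' with h | h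
        · exact key _ _ hs hs' hd hst' hq (lt_of_le_of_ne h hne)
        · exact key _ _ hs' hs hd' hst hq.symm (lt_of_le_of_ne h (Ne.symm hne))
    refine ((hfin1.image Coord.root).union (hfin2.image Coord.node)).subset ?_
    rintro (r | s) (hi : ε ≤ |_|)
    · refine Or.inl ⟨r, ?_, rfl⟩
      rw [hφr] at hi
      split_ifs at hi with hr
      · by_cases hrt : r ≤ t
        · rw [indic_of_le hrt, mul_one, abs_of_pos (ratWeight_pos _)] at hi
          exact ⟨hr, hrt, hi⟩
        · rw [indic_of_not_le hrt, mul_zero, abs_zero] at hi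
          exact absurd hi (not_le_of_gt hε)
      · rw [abs_zero] at hi
        exact absurd hi (not_le_of_gt hε)
    · refine Or.inr ⟨s, ?_, rfl⟩
      rw [hφs] at hi
      split_ifs at hi with hs
      · by_cases hd : drop ρ s (indic t) = 0
        · rw [hd, mul_zero, abs_zero] at hi
          exact absurd hi (not_le_of_gt hε)
        · refine ⟨hs, hd, hi.trans ?_⟩
          have h1 := (drop_indic_ne_zero hs.finite_levelSucc hd).2.2
          rw [mul_assoc, abs_mul, abs_mul, abs_of_pos (ratWeight_pos _), abs_of_pos (hc s)]
          have h2 : c s * |drop ρ s (indic t)| ≤ 1 := by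
            nlinarith [hc s, hc1 s, abs_nonneg (drop ρ s (indic t))]
          nlinarith [ratWeight_pos (qs s)]
      · rw [abs_zero] at hi
        exact absurd hi (not_le_of_gt hε)
  obtain ⟨T, hT⟩ := exists_operator_of_finite φ hbound hfin
  exact ⟨T, fun r => ratWeight (qr r), fun s => ratWeight (qs s) * c s,
    fun r => ratWeight_pos _, fun s => mul_pos (ratWeight_pos _) (hc s),
    fun f r => by rw [hT, hφr], fun f s => by rw [hT, hφs]⟩

end Operator

/-! ### Functions with vanishing drops -/

section Branches

variable {Υ : Type u} [PartialOrder Υ]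

/-- Choose z in the chain with fewest elements of `s` above it. Any later y then has the same
elements of `s` above it, so one upper bound serves all. -/
theorem IsChain.exists_subset_Iic {Z : Set Υ} (hZ : IsChain (· ≤ ·) Z) (hne : Z.Nonempty)
    {s : Finset Υ} (hs : ∀ z ∈ Z, ∃ t ∈ s, z ≤ t) : ∃ t, Z ⊆ Iic t := by
  classical
  obtain ⟨z, hz, hmin⟩ := WellFounded.has_min
    (measure fun z => (s.filter fun t => z ≤ t).card).wf Z hne
  obtain ⟨t, hts, hzt⟩ := hs z hz
  refine ⟨t, fun y hy => ?_⟩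
  rcases hZ.total hy hz with h | h
  · exact h.trans hzt
  · have hsub : (s.filter fun t => y ≤ t) ⊆ s.filter fun t => z ≤ t :=
      Finset.monotone_filter_right s fun t _ hyt => h.trans hyt
    have heq := Finset.eq_of_subset_of_card_le hsub (not_lt.1 (hmin y hy))
    have : t ∈ s.filter fun t => y ≤ t := heq ▸ Finset.mem_filter.2 ⟨hts, hzt⟩
    exact (Finset.mem_filter.1 this).2

variable [TopologicalSpace Υ] [IsHausdorffTree Υ] [IsTreeTopology Υ]

/-- On a part of a level without bad points, a function with vanishing drops is zero. -/
theorem IsRegularPotential.exists_drop_ne_zero {ρ : Υ → ℝ} (hρ : IsRegularPotential ρ)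
    {f : C₀(Υ, ℝ)} {t : Υ} (ht : f t ≠ 0)
    (hbad : ∀ b, IsBadPoint ρ b → t ≤ b → ρ b ≠ ρ t) :
    ∃ s, t ≤ s ∧ ρ s = ρ t ∧ IsGoodPoint ρ s ∧ drop ρ s f ≠ 0 := by
  by_contra! hdrop
  have hgood : ∀ s, t ≤ s → ρ s = ρ t → IsGoodPoint ρ s := fun s hs hst => by
    by_contra h
    exact hbad s h hs hst
  set Γ : Set Υ := {x | t ≤ x ∧ ρ x = ρ t ∧ f x ≠ 0}
  have hΓ : ¬ IsEverBranching Γ := fun h =>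
    hρ.not_const Γ ⟨t, le_rfl, rfl, ht⟩ h ⟨ρ t, fun x hx => hx.2.1⟩
  simp only [IsEverBranching, not_forall, not_not] at hΓ
  obtain ⟨x₀, hx₀, hchain⟩ := hΓ
  -- Above x₀ the support of f on this level is a chain. The points where f keeps the value f(x₀)
  -- lie below a single θ, and their supremum w belongs to Z by continuity of f and left continuity
  -- of ρ.
  set Z : Set Υ := {y | x₀ ≤ y ∧ ρ y = ρ t ∧ f y = f x₀}
  have hZΓ : Z ⊆ Γ ∩ Ici x₀ := fun y hy =>
    ⟨⟨hx₀.1.trans hy.1, hy.2.1, fun h => hx₀.2.2 (hy.2.2.symm.trans h)⟩, hy.1⟩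
  have hx₀Z : x₀ ∈ Z := ⟨le_rfl, hx₀.2.1, rfl⟩
  obtain ⟨s, hs⟩ := exists_finset_forall_abs_lt f (abs_pos.2 hx₀.2.2)
  obtain ⟨θ, hθ⟩ := IsChain.exists_subset_Iic (hchain.mono hZΓ) ⟨x₀, hx₀Z⟩
    fun z hz => hs z (by rw [hz.2.2])
  obtain ⟨w, -, hub, hw⟩ := exists_isLUB ⟨x₀, hx₀Z⟩ hθ
  have hwZ : w ∈ Z := by
    rcases hw with h | ⟨hlim, hcof⟩
    · exact h
    · refine ⟨hub _ hx₀Z, le_antisymm ?_ ?_, ?_⟩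
      · by_contra hlt
        obtain ⟨x, hx, hxt⟩ := hρ.exists_lt w hlim _ (not_le.1 hlt)
        obtain ⟨z, hz, hxz⟩ := hcof x hx
        linarith [hρ.mono hxz.le, hz.2.1]
      · exact hρ.mono (hx₀.1.trans (hub _ hx₀Z))
      · refine eq_of_forall_lt_exists_eq f hlim fun x hx => ?_
        obtain ⟨z, hz, hxz⟩ := hcof x hx
        exact ⟨z, hxz, hub z hz, hz.2.2⟩
  have htw : t ≤ w := (hZΓ hwZ).1.1
  have hgw := hgood w htw hwZ.2.1
  have hd := hdrop w htw hwZ.2.1 hgw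
  rw [drop_eq hgw.finite_levelSucc, sub_eq_zero] at hd
  obtain ⟨v, hv, hfv⟩ := Finset.exists_ne_zero_of_sum_ne_zero
    (hd ▸ (hZΓ hwZ).1.2.2)
  have hmem : ∀ v ∈ levelSucc ρ w, f v ≠ 0 → v ∈ Γ ∩ Ici x₀ := fun v hv hfv =>
    ⟨⟨htw.trans hv.1.le, hv.2.trans hwZ.2.1, hfv⟩, hwZ.1.trans hv.1.le⟩
  have hv' := hgw.finite_levelSucc.mem_toFinset.1 hv
  -- The chain property leaves only one level successor v of w with f(v) nonzero. Zero drop then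
  -- gives f(v) = f(w), so v belongs to Z above its supremum.
  rw [Finset.sum_eq_single_of_mem v hv] at hd
  · have : v ∈ Z := ⟨hwZ.1.trans hv'.1.le, hv'.2.trans hwZ.2.1, hd.symm.trans hwZ.2.2⟩
    exact absurd (hub v this) hv'.1.lt.not_ge
  · intro v' hv2 hne
    by_contra hfv'
    have hv2' := hgw.finite_levelSucc.mem_toFinset.1 hv2
    rcases hchain.total (hmem v hv' hfv) (hmem v' hv2' hfv') with h | h
    · exact hne (covBy_eq_of_le hv2'.1 hv'.1 le_rfl h)
    · exact hne (covBy_eq_of_le hv2'.1 hv'.1 h le_rfl)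

end Branches

/-! ### Key points and the recovery of a function from its active coordinates -/

section KeyPoints

variable {Υ : Type u} [PartialOrder Υ]

/-- The bad points on the level component of `y`. -/
def componentBad (ρ : Υ → ℝ) (y : Υ) : Set Υ :=
  {b | IsBadPoint ρ b ∧ ρ b = ρ y ∧ ∃ s, s ≤ y ∧ s ≤ b ∧ ρ s = ρ y}

/-- Two witnesses lie below y, hence are comparable; both bad points lie above the smaller witness
on its level. -/
theorem IsRegularPotential.componentBad_subsingleton [IsTree Υ] {ρ : Υ → ℝ}
    (hρ : IsRegularPotential ρ) (y : Υ) : (componentBad ρ y).Subsingleton := by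
  rintro b ⟨hb, hby, s, hsy, hsb, hs⟩ b' ⟨hb', hby', s', hsy', hsb', hs'⟩
  rcases le_or_le_of_le hsy hsy' with h | h
  · exact hρ.bad_subsingleton s ⟨hb, hsb, hby.trans hs.symm⟩
      ⟨hb', h.trans hsb', hby'.trans hs.symm⟩
  · exact hρ.bad_subsingleton s' ⟨hb, h.trans hsb, hby.trans hs'.symm⟩
      ⟨hb', hsb', hby'.trans hs'.symm⟩

/-- The points at which a function may change because of a given coordinate. -/
def Coord.keySet (ρ : Υ → ℝ) : Coord Υ → Set Υ
  | .root r => {x | x ⋖ r} ∪ componentBad ρ r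
  | .node s => {s} ∪ componentBad ρ s

theorem IsRegularPotential.finite_keySet [IsTree Υ] {ρ : Υ → ℝ} (hρ : IsRegularPotential ρ)
    (i : Coord Υ) : (i.keySet ρ).Finite := by
  rcases i with r | s
  · refine Set.Finite.union (Set.Subsingleton.finite fun x hx y hy => ?_)
      (hρ.componentBad_subsingleton r).finite
    exact covBy_left_unique hx hy
  · exact (finite_singleton s).union (hρ.componentBad_subsingleton s).finite

/-- The points at which a function may change because of a coordinate in `A`. -/
def keyPts (ρ : Υ → ℝ) (A : Set (Coord Υ)) : Set Υ := ⋃ i ∈ A, i.keySet ρ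

theorem keyPts_mono (ρ : Υ → ℝ) {A B : Set (Coord Υ)} (h : A ⊆ B) : keyPts ρ A ⊆ keyPts ρ B :=
  biUnion_subset_biUnion_left h

theorem mem_keyPts {ρ : Υ → ℝ} {A : Set (Coord Υ)} {i : Coord Υ} (hi : i ∈ A) {x : Υ}
    (hx : x ∈ i.keySet ρ) : x ∈ keyPts ρ A := mem_biUnion hi hx

theorem IsRegularPotential.finite_keyPts [IsTree Υ] {ρ : Υ → ℝ} (hρ : IsRegularPotential ρ)
    {A : Set (Coord Υ)} (hA : A.Finite) : (keyPts ρ A).Finite :=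
  hA.biUnion fun i _ => hρ.finite_keySet i

variable [TopologicalSpace Υ]

/-- The coordinates that are active for `f`. -/
def IsActive (ρ : Υ → ℝ) (f : C₀(Υ, ℝ)) : Coord Υ → Prop
  | .root r => IsRoot ρ r ∧ f r ≠ 0
  | .node s => IsGoodPoint ρ s ∧ drop ρ s f ≠ 0

/-- The set of the coordinates that are active for `f`. -/
def activeSet (ρ : Υ → ℝ) (f : C₀(Υ, ℝ)) : Set (Coord Υ) := {i | IsActive ρ f i}

/-- Arbitrarily small final intervals of `(0, w]` start at a root where `f` does not vanish. -/
def IsRootLimit (ρ : Υ → ℝ) (f : C₀(Υ, ℝ)) (w : Υ) : Prop :=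
  ∀ ε > 0, ∃ r < w, IsRoot ρ r ∧ f r ≠ 0 ∧ ∀ y, r ≤ y → y ≤ w → |f y - f w| < ε

variable {ρ : Υ → ℝ} {f : C₀(Υ, ℝ)}

theorem root_mem_activeSet {r : Υ} (hr : IsRoot ρ r) (hf : f r ≠ 0) :
    Coord.root r ∈ activeSet ρ f := ⟨hr, hf⟩

theorem node_mem_activeSet {s : Υ} (hs : IsGoodPoint ρ s) (hd : drop ρ s f ≠ 0) :
    Coord.node s ∈ activeSet ρ f := ⟨hs, hd⟩

theorem node_mem_keyPts {s : Υ} (hs : IsGoodPoint ρ s) (hd : drop ρ s f ≠ 0) :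
    s ∈ keyPts ρ (activeSet ρ f) :=
  mem_keyPts (node_mem_activeSet hs hd) (Or.inl rfl)

theorem bad_mem_keyPts_of_node {b s x : Υ} (hs : IsGoodPoint ρ s) (hd : drop ρ s f ≠ 0)
    (hb : IsBadPoint ρ b) (hbs : ρ b = ρ s) (hxs : x ≤ s) (hxb : x ≤ b) (hx : ρ x = ρ s) :
    b ∈ keyPts ρ (activeSet ρ f) :=
  mem_keyPts (node_mem_activeSet hs hd) (Or.inr ⟨hb, hbs, x, hxs, hxb, hx⟩)

variable [IsHausdorffTree Υ] [IsTreeTopology Υ]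

/-- Each x strictly between is good, by uniqueness of bad points, and has zero drop, since otherwise
b would be a key point. Side successors on the level carry the value 0, because a nonzero value
there would force an active node in the component of b. So f does not change on the way to b. -/
theorem IsRegularPotential.eq_of_le_bad (hρ : IsRegularPotential ρ) {b t : Υ}
    (hb : IsBadPoint ρ b) (hbP : b ∉ keyPts ρ (activeSet ρ f)) (htb : t ≤ b) (ht : ρ t = ρ b) :
    f b = f t := by
  refine eq_of_forall_covBy_eq f htb fun x y htx hxy hyb => ?_
  have hxb : x ≤ b := hxy.le.trans hyb
  have hρx : ρ x = ρ b := le_antisymm (hρ.mono hxb) (ht ▸ hρ.mono htx)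
  have hρy : ρ y = ρ x := le_antisymm (hρx ▸ hρ.mono hyb) (hρ.mono hxy.le)
  have hgx : IsGoodPoint ρ x := by
    by_contra hx
    have := hρ.bad_subsingleton x ⟨hx, le_rfl, rfl⟩ ⟨hb, hxb, hρx.symm⟩
    exact absurd (this ▸ hyb) hxy.lt.not_ge
  have hd : drop ρ x f = 0 := by
    by_contra hd
    exact hbP (bad_mem_keyPts_of_node hgx hd hb hρx.symm le_rfl hxb rfl)
  rw [drop_eq hgx.finite_levelSucc, sub_eq_zero] at hd
  rw [hd]
  refine Finset.sum_eq_single_of_mem y (hgx.finite_levelSucc.mem_toFinset.2 ⟨hxy, hρy⟩) ?_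
  intro v hv hvy
  obtain ⟨hxv, hρv⟩ := hgx.finite_levelSucc.mem_toFinset.1 hv
  by_contra hfv
  obtain ⟨s, hvs, hρs, hgs, hds⟩ := hρ.exists_drop_ne_zero hfv fun b' hb' hvb' hρb' => by
    have := hρ.bad_subsingleton x ⟨hb', hxv.le.trans hvb', hρb'.trans hρv⟩ ⟨hb, hxb, hρx.symm⟩
    exact hvy (covBy_eq_of_le hxv hxy (this ▸ hvb') hyb)
  have hsx : ρ s = ρ x := hρs.trans hρv
  exact hbP (bad_mem_keyPts_of_node hgs hds hb (hρx.symm.trans hsx.symm) (hxv.le.trans hvs) hxb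
    hsx.symm)

/-- If `f` does not vanish at a bad point `b` that is not a key point, then the level component of
`b` starts at a limit point, which is a limit of roots at which `f` does not vanish. -/
theorem IsRegularPotential.exists_limit_root (hρ : IsRegularPotential ρ) {b : Υ}
    (hb : IsBadPoint ρ b) (hbP : b ∉ keyPts ρ (activeSet ρ f)) (hfb : f b ≠ 0) :
    ∃ r ≤ b, ρ r = ρ b ∧ (∀ y ≤ b, ρ y = ρ b → r ≤ y) ∧ (∃ x, x < r) ∧
      ∀ x < r, ∀ ε > 0, ∃ r₁, x < r₁ ∧ r₁ < r ∧ IsRoot ρ r₁ ∧ f r₁ ≠ 0 ∧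
        ∀ y, r₁ ≤ y → y ≤ b → |f y - f b| < ε := by
  obtain ⟨r, ⟨hrb, hρr⟩, hl⟩ := exists_isLeast (C := {y | y ≤ b ∧ ρ y = ρ b}) (t := b)
    ⟨b, le_rfl, rfl⟩ fun y hy => hy.1
  have hfr : f b = f r := hρ.eq_of_le_bad hb hbP hrb hρr
  have hlt : ∀ x < r, ρ x < ρ r := fun x hx => by
    refine lt_of_le_of_ne (hρ.mono hx.le) fun h => ?_
    exact absurd (hl ⟨hx.le.trans hrb, h.trans hρr⟩) hx.not_ge
  -- Otherwise r, the start of the component, is an active root and b is one of its key points.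
  have hlim : Order.IsSuccLimit r := by
    by_contra hnl
    exact hbP (mem_keyPts (root_mem_activeSet ⟨hnl, hlt⟩ (hfr ▸ hfb))
      (Or.inr ⟨hb, hρr.symm, r, le_rfl, hrb, rfl⟩))
  refine ⟨r, hrb, hρr, fun y hy hρy => hl ⟨hy, hρy⟩, IsSuccLimit.exists_lt hlim,
    fun x hx ε hε => ?_⟩
  obtain ⟨x₀, hx₀, hx₀r⟩ := exists_Ioc_abs_sub_lt f hlim
    (lt_min hε (abs_pos.2 (hfr ▸ hfb)))
  obtain ⟨x₁, hx₁, hxx₁, hx₀x₁⟩ : ∃ x₁ < r, x ≤ x₁ ∧ x₀ ≤ x₁ := by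
    rcases le_or_le_of_le hx.le hx₀.le with h | h
    · exact ⟨x₀, hx₀, h, le_rfl⟩
    · exact ⟨x, hx, le_rfl, h⟩
  -- The first point where ρ exceeds ρ(x₁) cannot be a limit, by left continuity, so it is a root;
  -- closeness to f(r) keeps f nonzero there.
  obtain ⟨r₁, ⟨hr₁r, hρr₁⟩, hl₁⟩ := exists_isLeast (C := {y | y ≤ r ∧ ρ x₁ < ρ y}) (t := r)
    ⟨r, le_rfl, hlt x₁ hx₁⟩ fun y hy => hy.1
  have hbelow : ∀ y < r₁, ρ y ≤ ρ x₁ := fun y hy => by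
    by_contra h
    exact absurd (hl₁ ⟨hy.le.trans hr₁r, not_le.1 h⟩) hy.not_ge
  have hnl : ¬ Order.IsSuccLimit r₁ := fun h => by
    obtain ⟨y, hy, hyx⟩ := hρ.exists_lt r₁ h _ hρr₁
    exact absurd (hbelow y hy) (not_le_of_gt hyx)
  have hr₁lt : r₁ < r := lt_of_le_of_ne hr₁r fun h => hnl (h ▸ hlim)
  have hx₁r₁ : x₁ < r₁ := lt_of_not_le_of_le hr₁r hx₁.le fun h =>
    absurd (hρ.mono h) (not_le_of_gt hρr₁)
  have hnear : ∀ y, x₁ < y → y ≤ r → |f y - f r| < min ε |f r| := fun y hy hyr =>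
    hx₀r y (hx₀x₁.trans_lt hy) hyr
  refine ⟨r₁, hxx₁.trans_lt hx₁r₁, hr₁lt, ⟨hnl, fun y hy => (hbelow y hy).trans_lt hρr₁⟩, ?_,
    fun y hy hyb => ?_⟩
  · intro h0
    have := (hnear r₁ hx₁r₁ hr₁r).trans_le (min_le_right _ _)
    rw [h0, zero_sub, abs_neg] at this
    exact lt_irrefl _ this
  · rcases le_or_le_of_le hyb hrb with h | h
    · rw [hfr]
      exact (hnear y (hx₁r₁.trans_le hy) h).trans_le (min_le_left _ _)
    · rw [hρ.eq_of_le_bad hb hbP hyb (le_antisymm (hρ.mono hyb) (hρr ▸ hρ.mono h)), sub_self,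
        abs_zero]
      exact hε

theorem IsRegularPotential.isRootLimit (hρ : IsRegularPotential ρ) {b w : Υ}
    (hb : IsBadPoint ρ b) (hbP : b ∉ keyPts ρ (activeSet ρ f)) (hfb : f b ≠ 0) (hwb : w ≤ b)
    (hw : ρ w = ρ b) : IsRootLimit ρ f w := by
  intro ε hε
  obtain ⟨r, -, -, hrw, ⟨x, hx⟩, h⟩ := hρ.exists_limit_root hb hbP hfb
  obtain ⟨r₁, -, hr₁, hroot, hf, hnear⟩ := h x hx ε hε
  rw [← hρ.eq_of_le_bad hb hbP hwb hw]
  exact ⟨r₁, hr₁.trans_le (hrw w hwb hw), hroot, hf, fun y hy hyw => hnear y hy (hyw.trans hwb)⟩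

/-- At each point `w` the value `f w` is the value at the infimum of the key points above `w`, or
zero if there is none, or else `w` is a limit of roots. -/
theorem IsRegularPotential.value_cases (hρ : IsRegularPotential ρ) (f : C₀(Υ, ℝ)) (w : Υ) :
    ((keyPts ρ (activeSet ρ f) ∩ Ici w).Nonempty ∧
        ∃ m, IsGLB (keyPts ρ (activeSet ρ f) ∩ Ici w) m ∧ f w = f m) ∨
      (keyPts ρ (activeSet ρ f) ∩ Ici w = ∅ ∧ f w = 0) ∨ IsRootLimit ρ f w := by
  set P := keyPts ρ (activeSet ρ f) with hP
  rcases (P ∩ Ici w).eq_empty_or_nonempty with hemp | hne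
  · by_cases hfw : f w = 0
    · exact Or.inr (Or.inl ⟨hemp, hfw⟩)
    · have hnP : ∀ z, w ≤ z → z ∉ P := fun z hz hzP => (hemp ▸ ⟨hzP, hz⟩ : z ∈ (∅ : Set Υ))
      have : ∃ b, IsBadPoint ρ b ∧ w ≤ b ∧ ρ b = ρ w := by
        by_contra! hno
        obtain ⟨s, hws, -, hgs, hds⟩ := hρ.exists_drop_ne_zero hfw hno
        exact hnP s hws (node_mem_keyPts hgs hds)
      obtain ⟨b, hb, hwb, hρb⟩ := this
      have hbP := hnP b hwb
      exact Or.inr (Or.inr (hρ.isRootLimit hb hbP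
        (hρ.eq_of_le_bad hb hbP hwb hρb.symm ▸ hfw) hwb hρb.symm))
  · obtain ⟨m, hm⟩ := exists_isGLB hne fun z hz => hz.2
    have hwm : w ≤ m := hm.2 fun z hz => hz.2
    by_cases hfm : f w = f m
    · exact Or.inl ⟨hne, m, hm, hfm⟩
    refine Or.inr (Or.inr ?_)
    have hC : ∃ x y, w ≤ x ∧ x ⋖ y ∧ y ≤ m ∧ f x ≠ f y := by
      by_contra! hno
      exact hfm (eq_of_forall_covBy_eq f hwm hno).symm
    -- x is the first place between w and m where f changes at a successor. Lying above w but
    -- strictly below m, it is not a key point, and neither is any point above a successor of x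
    -- other than y.
    obtain ⟨x, ⟨hwx, y, hxy, hym, hfxy⟩, hl⟩ := exists_isLeast
      (C := {x | w ≤ x ∧ ∃ y, x ⋖ y ∧ y ≤ m ∧ f x ≠ f y}) (t := m)
      (by obtain ⟨x, y, h1, h2⟩ := hC; exact ⟨x, h1, y, h2⟩)
      fun x hx => by obtain ⟨-, y, hy, hym, -⟩ := hx; exact hy.le.trans hym
    have hfx : f x = f w := eq_of_forall_covBy_eq f hwx fun x' y' hx' hy' hy'x => by
      by_contra hne'
      exact absurd (hl ⟨hx', y', hy', hy'x.trans (hxy.le.trans hym), hne'⟩)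
        (hy'.lt.trans_le hy'x).not_ge
    have hxm : x < m := hxy.lt.trans_le hym
    have hPm : ∀ z ∈ P, w ≤ z → m ≤ z := fun z hz hwz => hm.1 ⟨hz, hwz⟩
    have hxP : x ∉ P := fun h => absurd (hPm x h hwx) hxm.not_ge
    have hoff : ∀ v z, x ⋖ v → v ≠ y → v ≤ z → z ∉ P := fun v z hv hvy hvz hz =>
      hvy (covBy_eq_of_le hv hxy hvz (hym.trans (hPm z hz ((hwx.trans hv.le).trans hvz))))
    have hyroot : ρ y ≠ ρ x → f y = 0 := fun hne' => by
      by_contra hfy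
      refine hxP (mem_keyPts (root_mem_activeSet ⟨CovBy.not_isSuccLimit hxy, fun z hz => ?_⟩ hfy)
        (Or.inl hxy))
      have hzx : z ≤ x := by
        by_contra hzx
        exact hxy.2 (lt_of_not_le_of_le hz.le hxy.le hzx) hz
      exact (hρ.mono hzx).trans_lt (lt_of_le_of_ne (hρ.mono hxy.le) hne'.symm)
    -- If x is bad, take b = x: any nonzero f(y) would make x a key point. If x is good, its drop is
    -- zero, so some other level successor v has f(v) nonzero; with no key point above v, a bad
    -- point must lie there.
    have hmain : f x ≠ 0 ∧ ∃ b, IsBadPoint ρ b ∧ x ≤ b ∧ ρ b = ρ x ∧ b ∉ P := by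
      by_cases hbx : IsBadPoint ρ x
      · refine ⟨?_, x, hbx, le_rfl, rfl, hxP⟩
        have hfy : f y = 0 := by
          by_cases hρy : ρ y = ρ x
          · by_contra hfy
            obtain ⟨s, hys, hρs, hgs, hds⟩ := hρ.exists_drop_ne_zero hfy
              fun b' hb' hyb' hρb' => by
                have := hρ.bad_subsingleton x ⟨hb', hxy.le.trans hyb', hρb'.trans hρy⟩
                  ⟨hbx, le_rfl, rfl⟩
                exact absurd (this ▸ hyb') hxy.lt.not_ge
            have hsx : ρ s = ρ x := hρs.trans hρy
            exact hxP (bad_mem_keyPts_of_node hgs hds hbx hsx.symm (hxy.le.trans hys) le_rfl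
              hsx.symm)
          · exact hyroot hρy
        exact fun hx0 => hfxy (hx0.trans hfy.symm)
      · have hgx : IsGoodPoint ρ x := not_not.1 hbx
        have hd : drop ρ x f = 0 := by
          by_contra hd
          exact hxP (node_mem_keyPts hgx hd)
        rw [drop_eq hgx.finite_levelSucc, sub_eq_zero] at hd
        have hex : ∃ v ∈ levelSucc ρ x, v ≠ y ∧ f v ≠ 0 := by
          by_contra! hno
          by_cases hρy : ρ y = ρ x
          · refine hfxy (hd.trans (Finset.sum_eq_single_of_mem y
              (hgx.finite_levelSucc.mem_toFinset.2 ⟨hxy, hρy⟩) fun v hv hvy => ?_))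
            exact hno v (hgx.finite_levelSucc.mem_toFinset.1 hv) hvy
          · refine hfxy (hd.trans ?_)
            rw [hyroot hρy]
            refine Finset.sum_eq_zero fun v hv => ?_
            have hv' := hgx.finite_levelSucc.mem_toFinset.1 hv
            exact hno v hv' fun h => hρy (h ▸ hv'.2)
        obtain ⟨v, ⟨hxv, hρv⟩, hvy, hfv⟩ := hex
        have : ∃ b, IsBadPoint ρ b ∧ v ≤ b ∧ ρ b = ρ v := by
          by_contra! hno
          obtain ⟨s, hvs, -, hgs, hds⟩ := hρ.exists_drop_ne_zero hfv hno
          exact hoff v s hxv hvy hvs (node_mem_keyPts hgs hds)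
        obtain ⟨b, hb, hvb, hρb⟩ := this
        have hbP := hoff v b hxv hvy hvb
        have hρbx := hρb.trans hρv
        refine ⟨?_, b, hb, hxv.le.trans hvb, hρbx, hbP⟩
        rw [← hρ.eq_of_le_bad hb hbP (hxv.le.trans hvb) hρbx.symm,
          hρ.eq_of_le_bad hb hbP hvb hρb.symm]
        exact hfv
    obtain ⟨hfx0, b, hb, hxb, hρb, hbP⟩ := hmain
    have hfb : f b ≠ 0 := hρ.eq_of_le_bad hb hbP hxb hρb.symm ▸ hfx0
    by_cases hρw : ρ w = ρ x
    · exact hρ.isRootLimit hb hbP hfb (hwx.trans hxb) (hρw.trans hρb.symm)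
    -- When w lies on a lower level, an active root r₁ occurs strictly between w and r; its
    -- predecessor is a key point above w but strictly below m.
    · exfalso
      obtain ⟨r, hrb, hρr, hrl, -, hroots⟩ := hρ.exists_limit_root hb hbP hfb
      have hrx : r ≤ x := hrl x hxb hρb.symm
      have hwr : w < r := lt_of_not_le_of_le hrx hwx fun h =>
        hρw (le_antisymm (hρ.mono hwx) (by rw [← hρb, ← hρr]; exact hρ.mono h))
      obtain ⟨r₁, hwr₁, hr₁r, hr₁, hfr₁, -⟩ := hroots w hwr 1 one_pos
      obtain ⟨x', hx'⟩ := (exists_covBy_of_not_isSuccLimit hr₁.1).resolve_left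
        fun h => h w hwr₁
      have hwx' : w ≤ x' := by
        by_contra h
        exact hx'.2 (lt_of_not_le_of_le hwr₁.le hx'.le h) hwr₁
      have hmx' := hPm x' (mem_keyPts (root_mem_activeSet hr₁ hfr₁) (Or.inl hx')) hwx'
      exact lt_irrefl m (calc m ≤ x' := hmx'
        _ < r₁ := hx'.lt
        _ < r := hr₁r
        _ ≤ x := hrx
        _ < m := hxm)

/-- A function without active coordinates vanishes. -/
theorem IsRegularPotential.eq_zero (hρ : IsRegularPotential ρ) (hf : activeSet ρ f = ∅) :
    f = 0 := by
  ext w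
  have hP : keyPts ρ (activeSet ρ f) = ∅ := by simp [hf, keyPts]
  rcases hρ.value_cases f w with h | h | h
  · rw [hP, empty_inter] at h
    exact absurd h.1 not_nonempty_empty
  · exact h.2
  · obtain ⟨r, -, hr, hfr, -⟩ := h 1 one_pos
    have : Coord.root r ∈ activeSet ρ f := ⟨hr, hfr⟩
    rw [hf] at this
    exact absurd this (notMem_empty _)

end KeyPoints

/-! ### Prediction of values from finitely many coordinates -/

section Approximation

variable {Υ : Type u} [PartialOrder Υ]

open Classical in
/-- The greatest lower bound of a set, if the set is nonempty and has one. -/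
noncomputable def glbPt (S : Set Υ) : Option Υ :=
  if h : S.Nonempty ∧ ∃ m, IsGLB S m then some h.2.choose else none

open Classical in
/-- The greatest element of a set, if it has one. -/
noncomputable def maxPt (S : Set Υ) : Option Υ :=
  if h : ∃ m, IsGreatest S m then some h.choose else none

theorem glbPt_eq_some {S : Set Υ} {m : Υ} (hS : S.Nonempty) (hm : IsGLB S m) :
    glbPt S = some m := by
  have h : S.Nonempty ∧ ∃ m, IsGLB S m := ⟨hS, m, hm⟩
  rw [glbPt, dif_pos h, h.2.choose_spec.unique hm]

theorem of_glbPt_eq_some {S : Set Υ} {m : Υ} (h : glbPt S = some m) : S.Nonempty ∧ IsGLB S m := by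
  unfold glbPt at h
  split_ifs at h with hS
  exact ⟨hS.1, Option.some.inj h ▸ hS.2.choose_spec⟩

theorem maxPt_eq_some {S : Set Υ} {m : Υ} (hm : IsGreatest S m) : maxPt S = some m := by
  have h : ∃ m, IsGreatest S m := ⟨m, hm⟩
  rw [maxPt, dif_pos h, h.choose_spec.unique hm]

theorem of_maxPt_eq_some {S : Set Υ} {m : Υ} (h : maxPt S = some m) : IsGreatest S m := by
  unfold maxPt at h
  split_ifs at h with hS
  exact Option.some.inj h ▸ hS.choose_spec

/-- The infimum of the key points above `t`. -/
noncomputable def headPt (ρ : Υ → ℝ) (A : Set (Coord Υ)) (t : Υ) : Option Υ :=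
  glbPt (keyPts ρ A ∩ Ici t)

/-- The last root of `A` below `t`. -/
noncomputable def rootPt (A : Set (Coord Υ)) (t : Υ) : Option Υ :=
  maxPt ({r | Coord.root r ∈ A} ∩ Iic t)

/-- The key points above t are exactly those above their infimum m. Consequently the estimate at m
involves m as its own head. -/
theorem headPt_headPt {ρ : Υ → ℝ} {A : Set (Coord Υ)} {t m : Υ} (h : headPt ρ A t = some m) :
    headPt ρ A m = some m := by
  have hm := (of_glbPt_eq_some h).2
  have htm : t ≤ m := hm.2 fun z hz => hz.2
  have : keyPts ρ A ∩ Ici m = keyPts ρ A ∩ Ici t :=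
    Subset.antisymm (fun z hz => ⟨hz.1, htm.trans hz.2⟩) fun z hz => ⟨hz.1, hm.1 hz⟩
  rw [headPt, this]
  exact h

/-- Each label is computed from a subset of a finite set of key points and a subset of a finite set
of roots. -/
theorem IsRegularPotential.finite_range_labels [IsTree Υ] {ρ : Υ → ℝ} (hρ : IsRegularPotential ρ)
    {A : Set (Coord Υ)} (hA : A.Finite) :
    (range fun t => (headPt ρ A t, rootPt A t)).Finite := by
  have h1 : (range (headPt ρ A)).Finite := by
    refine ((hρ.finite_keyPts hA).finite_subsets.image glbPt).subset ?_
    rintro _ ⟨t, rfl⟩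
    exact ⟨_, inter_subset_left, rfl⟩
  have h2 : (range (rootPt A)).Finite := by
    have hfin : {r | Coord.root r ∈ A}.Finite :=
      hA.preimage fun x _ y _ h => Coord.root.inj h
    refine (hfin.finite_subsets.image maxPt).subset ?_
    rintro _ ⟨t, rfl⟩
    exact ⟨_, inter_subset_left, rfl⟩
  refine (h1.prod h2).subset ?_
  rintro _ ⟨t, rfl⟩
  exact ⟨⟨t, rfl⟩, t, rfl⟩

variable [TopologicalSpace Υ]

variable {ρ : Υ → ℝ} [IsHausdorffTree Υ]

/-- Infima over finite sets of coordinates decrease as the set grows, so by well-foundedness a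
minimal one exists. It is stable under enlargement and hence equals the infimum over all active
coordinates. -/
theorem exists_finite_headPt_eq (f : C₀(Υ, ℝ)) {w m : Υ}
    (hne : (keyPts ρ (activeSet ρ f) ∩ Ici w).Nonempty)
    (hm : IsGLB (keyPts ρ (activeSet ρ f) ∩ Ici w) m) :
    ∃ A₀ ⊆ activeSet ρ f, A₀.Finite ∧ ∀ A, A₀ ⊆ A → A ⊆ activeSet ρ f →
      (keyPts ρ A ∩ Ici w).Nonempty ∧ IsGLB (keyPts ρ A ∩ Ici w) m := by
  set C : Set Υ := {g | ∃ A ⊆ activeSet ρ f, A.Finite ∧ (keyPts ρ A ∩ Ici w).Nonempty ∧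
    IsGLB (keyPts ρ A ∩ Ici w) g} with hC
  have hsing : ∀ p ∈ keyPts ρ (activeSet ρ f), ∃ i ∈ activeSet ρ f, p ∈ keyPts ρ {i} := by
    intro p hp
    obtain ⟨i, hi, hpi⟩ := mem_iUnion₂.1 hp
    exact ⟨i, hi, mem_keyPts (mem_singleton i) hpi⟩
  have hCne : C.Nonempty := by
    obtain ⟨p, hp, hwp⟩ := hne
    obtain ⟨i, hi, hpi⟩ := hsing p hp
    obtain ⟨g, hg⟩ := exists_isGLB (B := keyPts ρ {i} ∩ Ici w) ⟨p, hpi, hwp⟩ fun z hz => hz.2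
    exact ⟨g, {i}, singleton_subset_iff.2 hi, finite_singleton i, ⟨p, hpi, hwp⟩, hg⟩
  obtain ⟨g, ⟨A₀, hA₀, hfin, hne₀, hg⟩, hmin⟩ :=
    WellFounded.has_min (wellFounded_lt (α := Υ)) C hCne
  have hstable : ∀ A, A₀ ⊆ A → A ⊆ activeSet ρ f → A.Finite →
      IsGLB (keyPts ρ A ∩ Ici w) g := by
    intro A hA hAf hAfin
    have hsub : keyPts ρ A₀ ∩ Ici w ⊆ keyPts ρ A ∩ Ici w :=
      inter_subset_inter_left _ (keyPts_mono ρ hA)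
    obtain ⟨g', hg'⟩ := exists_isGLB (hne₀.mono hsub) fun z hz => hz.2
    have hle : g' ≤ g := hg.2 fun z hz => hg'.1 (hsub hz)
    have := hmin g' ⟨A, hAf, hAfin, hne₀.mono hsub, hg'⟩
    rwa [← eq_of_le_of_not_lt hle this]
  have hgm : g = m := by
    refine le_antisymm (hm.2 fun p hp => ?_) (hg.2 fun p hp => hm.1 ⟨keyPts_mono ρ hA₀ hp.1, hp.2⟩)
    obtain ⟨i, hi, hpi⟩ := hsing p hp.1
    refine (hstable (insert i A₀) (subset_insert _ _) (insert_subset hi hA₀) (hfin.insert i)).1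
      ⟨keyPts_mono ρ (singleton_subset_iff.2 (mem_insert i A₀)) hpi, hp.2⟩
  subst hgm
  refine ⟨A₀, hA₀, hfin, fun A hA hAf => ?_⟩
  have hsub : keyPts ρ A₀ ∩ Ici w ⊆ keyPts ρ A ∩ Ici w :=
    inter_subset_inter_left _ (keyPts_mono ρ hA)
  exact ⟨hne₀.mono hsub, fun p hp => hm.1 ⟨keyPts_mono ρ hAf hp.1, hp.2⟩,
    fun c hc => hg.2 fun p hp => hc (hsub hp)⟩

variable [IsTreeTopology Υ]

theorem exists_convex_nhds (f : C₀(Υ, ℝ)) (w : Υ) {ε : ℝ} (hε : 0 < ε) :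
    ∃ U ∈ 𝓝 w, ∀ t ∈ U, t ≤ w ∧ ∀ y, t ≤ y → y ≤ w → |f y - f w| < ε := by
  by_cases hw : Order.IsSuccLimit w
  · obtain ⟨x, hx, h⟩ := exists_Ioc_abs_sub_lt f hw hε
    exact ⟨_, Ioc_mem_nhds_tree hx, fun t ht => ⟨ht.2, fun y hy hyw => h y (ht.1.trans_le hy) hyw⟩⟩
  · refine ⟨_, singleton_mem_nhds_of_not_isSuccLimit hw, ?_⟩
    rintro t rfl
    refine ⟨le_rfl, fun y hy hyw => ?_⟩
    rw [le_antisymm hyw hy, sub_self, abs_zero]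
    exact hε

/-- The value `f t` is close to one of the two values predicted by the coordinates in `A`. -/
def IsPredicted (ρ : Υ → ℝ) (f : C₀(Υ, ℝ)) (ε : ℝ) (A : Set (Coord Υ)) (t : Υ) : Prop :=
  |f t - optEval (headPt ρ A t) f| < ε ∨ |f t - optEval (rootPt A t) f| < ε

/-- The cases are those of `IsRegularPotential.value_cases`. In the first two the head of t
predicts; at a limit of roots the last root below t does. -/
theorem IsRegularPotential.exists_nhds_isPredicted (hρ : IsRegularPotential ρ) (f : C₀(Υ, ℝ))
    (w : Υ) {ε : ℝ} (hε : 0 < ε) :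
    ∃ U ∈ 𝓝 w, ∃ A₀ ⊆ activeSet ρ f, A₀.Finite ∧ ∀ A, A₀ ⊆ A → A ⊆ activeSet ρ f → A.Finite →
      ∀ t ∈ U, IsPredicted ρ f ε A t := by
  obtain ⟨U, hU, hUw⟩ := exists_convex_nhds f w (half_pos hε)
  have hclose : ∀ t ∈ U, ∀ y, t ≤ y → y ≤ w → |f t - f y| < ε := fun t ht y hty hyw => by
    have h1 := abs_lt.1 ((hUw t ht).2 t le_rfl (hUw t ht).1)
    have h2 := abs_lt.1 ((hUw t ht).2 y hty hyw)
    exact abs_lt.2 ⟨by linarith, by linarith⟩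
  rcases hρ.value_cases f w with ⟨hne, m, hm, hfm⟩ | ⟨hemp, hfw⟩ | hlim
  · obtain ⟨A₀, hA₀, hfin, hA₀m⟩ := exists_finite_headPt_eq f hne hm
    refine ⟨U, hU, A₀, hA₀, hfin, fun A hA hAf _ t ht => Or.inl ?_⟩
    obtain ⟨hneA, hmA⟩ := hA₀m A hA hAf
    have htw := (hUw t ht).1
    have hsub : keyPts ρ A ∩ Ici w ⊆ keyPts ρ A ∩ Ici t := fun z hz => ⟨hz.1, htw.trans hz.2⟩
    obtain ⟨m', hm'⟩ := exists_isGLB (hneA.mono hsub) fun z hz => hz.2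
    rw [headPt, glbPt_eq_some (hneA.mono hsub) hm', optEval_some]
    obtain ⟨p, hp⟩ := hneA
    have htm' : t ≤ m' := hm'.2 fun z hz => hz.2
    -- The head m' of t is either in [t,w], where f is nearly constant, or above w, in which case it
    -- is the head m of w.
    rcases le_or_le_of_le (hm'.1 (hsub hp)) hp.2 with h | h
    · exact hclose t ht m' htm' h
    · have : m' = m := le_antisymm (hmA.2 fun z hz => hm'.1 (hsub hz))
        (hm'.2 fun z hz => hmA.1 ⟨hz.1, le_trans h (hm'.1 hz)⟩)
      rw [this, ← hfm]
      exact hclose t ht w htw le_rfl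
  · obtain ⟨s, hs⟩ := exists_finset_forall_abs_lt f (half_pos hε)
    -- Removing the sets (0,θ] that miss w ensures that a head of t with a large value shares some
    -- (0,θ] with w. It must then lie below w, since no key point is above w.
    have hV : (⋂ θ ∈ (s : Set Υ) ∩ {θ | ¬ w ≤ θ}, (Iic θ)ᶜ) ∈ 𝓝 w := by
      refine (biInter_mem (s.finite_toSet.inter_of_left _)).2 fun θ hθ => ?_
      exact (isClosed_Iic_tree θ).isOpen_compl.mem_nhds hθ.2
    refine ⟨U ∩ _, inter_mem hU hV, ∅, empty_subset _, finite_empty,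
      fun A _ hAf _ t ht => Or.inl ?_⟩
    have hft : |f t| < ε / 2 := by
      have := (hUw t ht.1).2 t le_rfl (hUw t ht.1).1
      rwa [hfw, sub_zero] at this
    rcases ho : headPt ρ A t with _ | m'
    · rw [optEval_none, sub_zero]
      linarith
    · rw [optEval_some]
      obtain ⟨⟨p, hp⟩, hm'⟩ := of_glbPt_eq_some ho
      have htm' : t ≤ m' := hm'.2 fun z hz => hz.2
      by_cases hfm' : ε / 2 ≤ |f m'|
      · obtain ⟨θ, hθ, hm'θ⟩ := hs m' hfm'
        have hwθ : w ≤ θ := by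
          by_contra hwθ
          exact mem_iInter₂.1 ht.2 θ ⟨hθ, hwθ⟩ (htm'.trans hm'θ)
        rcases le_or_le_of_le hwθ hm'θ with h | h
        · have : p ∈ keyPts ρ (activeSet ρ f) ∩ Ici w :=
            ⟨keyPts_mono ρ hAf hp.1, h.trans (hm'.1 hp)⟩
          rw [hemp] at this
          exact absurd this (notMem_empty p)
        · exact hclose t ht.1 m' htm' h
      · have h1 := abs_lt.1 hft
        have h2 := abs_lt.1 (not_le.1 hfm')
        exact abs_lt.2 ⟨by linarith, by linarith⟩
  · obtain ⟨r, hrw, hr, hfr, hnear⟩ := hlim (ε / 2) (half_pos hε)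
    refine ⟨Ioc r w, Ioc_mem_nhds_tree hrw, {Coord.root r},
      singleton_subset_iff.2 (root_mem_activeSet hr hfr), finite_singleton _,
      fun A hA _ hAfin t ht => Or.inr ?_⟩
    -- Finiteness of A provides a last root below t; as r is among the candidates, it lies in [r,w],
    -- where f is close to f(w).
    have hfin : ({r | Coord.root r ∈ A} ∩ Iic t).Finite :=
      (hAfin.preimage fun x _ y _ h => Coord.root.inj h).inter_of_left _
    have hrA : r ∈ {r | Coord.root r ∈ A} ∩ Iic t :=
      ⟨hA (mem_singleton _), ht.1.le⟩
    obtain ⟨x, hx⟩ := hfin.exists_maximal ⟨r, hrA⟩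
    have hmax : IsGreatest ({r | Coord.root r ∈ A} ∩ Iic t) x := by
      refine ⟨hx.1, fun y hy => ?_⟩
      rcases le_or_le_of_le hy.2 hx.1.2 with h | h
      · exact h
      · exact hx.2 hy h
    rw [rootPt, maxPt_eq_some hmax, optEval_some]
    have h1 := abs_lt.1 (hnear t ht.1.le ht.2)
    have h2 := abs_lt.1 (hnear x (hmax.2 hrA) (le_trans hmax.1.2 ht.2))
    exact abs_lt.2 ⟨by linarith, by linarith⟩

/-- For all large finite sets of active coordinates, all values of `f` are predicted. -/
theorem IsRegularPotential.exists_finite_isPredicted (hρ : IsRegularPotential ρ) (f : C₀(Υ, ℝ))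
    {ε : ℝ} (hε : 0 < ε) :
    ∃ A₀ ⊆ activeSet ρ f, A₀.Finite ∧ ∀ A, A₀ ⊆ A → A ⊆ activeSet ρ f → A.Finite →
      ∀ t, IsPredicted ρ f ε A t := by
  obtain ⟨s, hs⟩ := exists_finset_forall_abs_lt f (half_pos hε)
  -- K is compact, so finitely many local predictions suffice there. Off K, f is small on all of
  -- [t,∞), which contains the head of t if there is one.
  set K : Set Υ := ⋃ θ ∈ s, Iic θ
  have hK : IsCompact K := s.isCompact_biUnion fun θ _ => isCompact_Iic_tree θ
  obtain ⟨A₀, hA₀, hfin, h⟩ : ∃ A₀ ⊆ activeSet ρ f, A₀.Finite ∧ ∀ A, A₀ ⊆ A →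
      A ⊆ activeSet ρ f → A.Finite → ∀ t ∈ K, IsPredicted ρ f ε A t := by
    refine hK.induction_on (p := fun S => ∃ A₀ ⊆ activeSet ρ f, A₀.Finite ∧ ∀ A, A₀ ⊆ A →
      A ⊆ activeSet ρ f → A.Finite → ∀ t ∈ S, IsPredicted ρ f ε A t) ?_ ?_ ?_ ?_
    · exact ⟨∅, empty_subset _, finite_empty, fun A _ _ _ t ht => absurd ht (notMem_empty t)⟩
    · rintro S S' hSS' ⟨A₀, hA₀, hfin, h⟩
      exact ⟨A₀, hA₀, hfin, fun A h1 h2 h3 t ht => h A h1 h2 h3 t (hSS' ht)⟩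
    · rintro S S' ⟨A₀, hA₀, hfin, h⟩ ⟨A₁, hA₁, hfin₁, h₁⟩
      refine ⟨A₀ ∪ A₁, union_subset hA₀ hA₁, hfin.union hfin₁, fun A hA h2 h3 t ht => ?_⟩
      rcases ht with ht | ht
      · exact h A (subset_union_left.trans hA) h2 h3 t ht
      · exact h₁ A (subset_union_right.trans hA) h2 h3 t ht
    · intro w _
      obtain ⟨U, hU, hA₀⟩ := hρ.exists_nhds_isPredicted f w hε
      exact ⟨U, mem_nhdsWithin_of_mem_nhds hU, hA₀⟩
  refine ⟨A₀, hA₀, hfin, fun A h1 h2 h3 t => ?_⟩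
  by_cases ht : t ∈ K
  · exact h A h1 h2 h3 t ht
  · have hsmall : ∀ x, t ≤ x → |f x| < ε / 2 := fun x htx => by
      by_contra hx
      obtain ⟨θ, hθ, hxθ⟩ := hs x (not_lt.1 hx)
      exact ht (mem_biUnion (x := θ) hθ (htx.trans hxθ))
    have h4 := abs_lt.1 (hsmall t le_rfl)
    refine Or.inl ?_
    rcases ho : headPt ρ A t with _ | m
    · rw [optEval_none, sub_zero]
      exact abs_lt.2 ⟨by linarith, by linarith⟩
    · have h5 := abs_lt.1 (hsmall m ((of_glbPt_eq_some ho).2.2 fun z hz => hz.2))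
      rw [optEval_some]
      exact abs_lt.2 ⟨by linarith, by linarith⟩

end Approximation

/-! ### Separation of the large coordinates, labels and test functionals -/

theorem sum_sq_add_le_of_ne {ι : Type*} [DecidableEq ι] {u : ι → ℝ} {A B : Finset ι} {a b : ℝ}
    (hab : b ≤ a) (hA : ∀ i ∈ A, a ≤ u i ^ 2) (hB : ∀ i ∉ A, u i ^ 2 ≤ b)
    (hcard : B.card = A.card) (hne : B ≠ A) :
    ∑ i ∈ B, u i ^ 2 + (a - b) ≤ ∑ i ∈ A, u i ^ 2 := by
  have h1 : ∑ i ∈ B, u i ^ 2 = ∑ i ∈ B ∩ A, u i ^ 2 + ∑ i ∈ B \ A, u i ^ 2 :=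
    (Finset.sum_inter_add_sum_sdiff B A _).symm
  have h2 : ∑ i ∈ A, u i ^ 2 = ∑ i ∈ A ∩ B, u i ^ 2 + ∑ i ∈ A \ B, u i ^ 2 :=
    (Finset.sum_inter_add_sum_sdiff A B _).symm
  have h3 : ∑ i ∈ B \ A, u i ^ 2 ≤ (B \ A).card * b := by
    rw [← nsmul_eq_mul]
    exact Finset.sum_le_card_nsmul _ _ _ fun i hi => hB i (Finset.mem_sdiff.1 hi).2
  have h4 : (A \ B).card * a ≤ ∑ i ∈ A \ B, u i ^ 2 := by
    rw [← nsmul_eq_mul]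
    exact Finset.card_nsmul_le_sum _ _ _ fun i hi => hA i (Finset.mem_sdiff.1 hi).1
  have h5 : (B \ A).card = (A \ B).card := Finset.card_sdiff_comm hcard
  have h6 : (1 : ℝ) ≤ (A \ B).card := by
    have : (A \ B).Nonempty := by
      rw [Finset.sdiff_nonempty]
      exact fun h => hne (Finset.eq_of_subset_of_card_le h hcard.le).symm
    exact_mod_cast this.card_pos
  rw [h5] at h3
  rw [h1, h2, Finset.inter_comm]
  nlinarith

/-- The coordinates of size at least `η` of an element of `c₀` are separated from the others. -/
theorem exists_finset_gap {I : Type*} [TopologicalSpace I] [DiscreteTopology I] (u : C₀(I, ℝ))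
    {η : ℝ} (hη : 0 < η) :
    ∃ (A : Finset I) (b : ℝ), (∀ i, i ∈ A ↔ η ≤ |u i|) ∧ 0 ≤ b ∧ b < η ^ 2 ∧
      ∀ i ∉ A, u i ^ 2 ≤ b := by
  have hA := finite_setOf_le_abs u hη
  refine ⟨hA.toFinset, ?_⟩
  simp only [Finite.mem_toFinset, mem_ofPred_eq, implies_true, true_and]
  have hsmall : ∀ i, ¬ η ≤ |u i| → u i ^ 2 < η ^ 2 := fun i hi => by
    rw [← sq_abs (u i)]
    exact pow_lt_pow_left₀ (not_le.1 hi) (abs_nonneg _) two_ne_zero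
  have hhalf : (η / 2) ^ 2 < η ^ 2 :=
    pow_lt_pow_left₀ (half_lt_self hη) (half_pos hη).le two_ne_zero
  -- Only finitely many coordinates have size between η/2 and η, so their squares have a maximum
  -- below η²; otherwise (η/2)² serves as b.
  rcases ({i | η / 2 ≤ |u i|} ∩ {i | ¬ η ≤ |u i|}).eq_empty_or_nonempty with he | hne
  · refine ⟨(η / 2) ^ 2, sq_nonneg _, hhalf, fun i hi => ?_⟩
    rw [← sq_abs (u i)]
    refine pow_le_pow_left₀ (abs_nonneg _) ?_ 2
    by_contra h
    exact notMem_empty i (he ▸ ⟨(not_le.1 h).le, hi⟩)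
  · obtain ⟨m, hm, hmax⟩ := exists_max_image _ (fun i => u i ^ 2)
      ((finite_setOf_le_abs u (half_pos hη)).inter_of_left _) hne
    refine ⟨u m ^ 2, sq_nonneg _, hsmall m hm.2, fun i hi => ?_⟩
    by_cases h : η / 2 ≤ |u i|
    · exact hmax i ⟨h, hi⟩
    · rw [← sq_abs (u i), ← sq_abs (u m)]
      exact pow_le_pow_left₀ (abs_nonneg _) ((not_le.1 h).le.trans hm.1) 2

section Labels

variable {Υ : Type u} [PartialOrder Υ]

/-- The pairs of points from which values are predicted. -/
noncomputable def IsRegularPotential.labels [IsTree Υ] {ρ : Υ → ℝ} (hρ : IsRegularPotential ρ)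
    (A : Finset (Coord Υ)) : Finset (Option Υ × Option Υ) :=
  (hρ.finite_range_labels A.finite_toSet).toFinset

theorem IsRegularPotential.mem_labels [IsTree Υ] {ρ : Υ → ℝ} (hρ : IsRegularPotential ρ)
    (A : Finset (Coord Υ)) (t : Υ) : (headPt ρ A t, rootPt (A : Set (Coord Υ)) t) ∈ hρ.labels A :=
  (Set.Finite.mem_toFinset _).2 ⟨t, rfl⟩

end Labels

section TestFunctional

variable {Υ : Type u} [TopologicalSpace Υ]

open Classical in
/-- The functionals whose squares are added in the construction of the norm. -/
noncomputable def testFunctional (T : C₀(Υ, ℝ) →L[ℝ] C₀(Coord Υ, ℝ)) (N : ℕ)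
    (A : Finset (Coord Υ)) (L : Finset (Option Υ × Option Υ)) (l : Option Υ × Option Υ) (t : Υ) :
    A ⊕ L → C₀(Υ, ℝ) →L[ℝ] ℝ
  | .inl i => (N : ℝ) • (evalCLM (i : Coord Υ) ∘L T)
  | .inr k => if k.1 = l then evalCLM t - (1 / 2 : ℝ) • (optEval l.1 + optEval l.2)
      else (1 / 2 : ℝ) • (optEval k.1.1 - optEval k.1.2)

theorem abs_testFunctional_le (T : C₀(Υ, ℝ) →L[ℝ] C₀(Coord Υ, ℝ)) (N : ℕ) (A : Finset (Coord Υ))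
    (L : Finset (Option Υ × Option Υ)) (l : Option Υ × Option Υ) (t : Υ) (k : A ⊕ L)
    (f : C₀(Υ, ℝ)) : |testFunctional T N A L l t k f| ≤ (N * ‖T‖ + 2) * ‖f‖ := by
  have h0 := norm_nonneg f
  have hN : (0 : ℝ) ≤ N := Nat.cast_nonneg N
  have h1 : 0 ≤ (N : ℝ) * ‖T‖ * ‖f‖ := by positivity
  rcases k with i | k
  · have : |testFunctional T N A L l t (.inl i) f| = N * |T f i| := by
      simp [testFunctional, abs_mul]
    rw [this]
    have h2 := (abs_apply_le_norm (T f) i).trans (T.le_opNorm f)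
    nlinarith [mul_le_mul_of_nonneg_left h2 hN]
  · have hl1 := abs_le.1 (abs_optEval_le l.1 f)
    have hl2 := abs_le.1 (abs_optEval_le l.2 f)
    have hk1 := abs_le.1 (abs_optEval_le k.1.1 f)
    have hk2 := abs_le.1 (abs_optEval_le k.1.2 f)
    have ht := abs_le.1 (abs_apply_le_norm f t)
    by_cases h : k.1 = l
    · have : testFunctional T N A L l t (.inr k) f =
          f t - 1 / 2 * (optEval l.1 f + optEval l.2 f) := by
        simp [testFunctional, h, mul_add]
      rw [this, abs_le]
      constructor <;> nlinarith
    · have : testFunctional T N A L l t (.inr k) f =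
          1 / 2 * (optEval k.1.1 f - optEval k.1.2 f) := by
        simp [testFunctional, h]
      rw [this, abs_le]
      constructor <;> nlinarith

/-- Completing the square, (x - (a + b)/2)² = ((a - b)/2)² + (x - a)(x - b). The middle sum
therefore runs over all labels, and t enters only through the last product. -/
theorem sum_testFunctional_sq (T : C₀(Υ, ℝ) →L[ℝ] C₀(Coord Υ, ℝ)) (N : ℕ) (A : Finset (Coord Υ))
    {L : Finset (Option Υ × Option Υ)} {l : Option Υ × Option Υ} (hl : l ∈ L) (t : Υ)
    (f : C₀(Υ, ℝ)) :
    ∑ k, testFunctional T N A L l t k f ^ 2 =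
      (N : ℝ) ^ 2 * ∑ i ∈ A, T f i ^ 2 + ∑ k ∈ L, (1 / 2 * (optEval k.1 f - optEval k.2 f)) ^ 2 +
        (f t - optEval l.1 f) * (f t - optEval l.2 f) := by
  classical
  have h1 : ∑ i : A, testFunctional T N A L l t (.inl i) f ^ 2 =
      (N : ℝ) ^ 2 * ∑ i ∈ A, T f i ^ 2 := by
    rw [Finset.mul_sum, ← Finset.sum_coe_sort A]
    exact Finset.sum_congr rfl fun i _ => by simp [testFunctional, mul_pow]
  have h2 : ∑ k : L, testFunctional T N A L l t (.inr k) f ^ 2 =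
      ∑ k ∈ L, if k = l then (f t - 1 / 2 * (optEval l.1 f + optEval l.2 f)) ^ 2
        else (1 / 2 * (optEval k.1 f - optEval k.2 f)) ^ 2 := by
    rw [← Finset.sum_coe_sort L]
    refine Finset.sum_congr rfl fun k _ => ?_
    by_cases h : k.1 = l <;> simp [testFunctional, h, mul_add]
  rw [Fintype.sum_sum_type, h1, h2, ← Finset.add_sum_erase L _ hl,
    ← Finset.add_sum_erase L (fun k => (1 / 2 * (optEval k.1 f - optEval k.2 f)) ^ 2) hl,
    Finset.sum_congr rfl fun k hk => if_neg (Finset.ne_of_mem_erase hk), if_pos rfl]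
  ring

end TestFunctional

/-! ### The MLUR norm and the injection -/

section Conclusion

variable {Υ : Type u} [PartialOrder Υ] [TopologicalSpace Υ] [IsHausdorffTree Υ] [IsTreeTopology Υ]

theorem IsRegularPotential.exists_mlurNorm {ρ : Υ → ℝ} (hρ : IsRegularPotential ρ) :
    ∃ p : Seminorm ℝ C₀(Υ, ℝ), IsEquivalentNorm p ∧ IsMLURNorm p := by
  classical
  obtain ⟨T, α, β, hα, hβ, hTr, hTs⟩ := exists_coord_operator (Υ := Υ) hρ.mono
  have hactive : ∀ f i, i ∈ activeSet ρ f ↔ T f i ≠ 0 := by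
    rintro f (r | s)
    · rw [hTr]
      split_ifs with h
      · exact ⟨fun h' => mul_ne_zero (hα r).ne' h'.2, fun h' => ⟨h, right_ne_zero_of_mul h'⟩⟩
      · exact ⟨fun h' => absurd h'.1 h, fun h' => absurd rfl h'⟩
    · rw [hTs]
      split_ifs with h
      · exact ⟨fun h' => mul_ne_zero (hβ s).ne' h'.2, fun h' => ⟨h, right_ne_zero_of_mul h'⟩⟩
      · exact ⟨fun h' => absurd h'.1 h, fun h' => absurd rfl h'⟩
  let lab : Finset (Coord Υ) → Υ → Option Υ × Option Υ := fun A t => (headPt ρ A t, rootPt A t)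
  have hlab : ∀ A t, lab A t ∈ hρ.labels A := hρ.mem_labels
  -- The three indices fix the cardinality of A, the weight N and a bound for the number of labels;
  -- together they bound each family uniformly.
  obtain ⟨p, hp, hkey⟩ := exists_equivalentNorm_of_families (X := C₀(Υ, ℝ)) (κ := ℕ × ℕ × ℕ)
    (α := fun k => {a : Finset (Coord Υ) × Υ // a.1.card = k.1 ∧ (hρ.labels a.1).card ≤ k.2.2})
    (fun k a => sumSqSeminorm
      (testFunctional T k.2.1 a.1.1 (hρ.labels a.1.1) (lab a.1.1 a.1.2) a.1.2))
    (fun k => ((k.1 + k.2.2 : ℕ) + 1) * (k.2.1 * ‖T‖ + 2)) (fun k => by positivity)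
    (fun k a x => sumSqSeminorm_le _ (by positivity) (abs_testFunctional_le T _ _ _ _ _)
      (by simpa [a.2.1] using a.2.2) x)
    fun _ _ x h => sumSqSeminorm_parallelogram _ x h
  refine ⟨p, hp, fun f h hlim => ?_⟩
  have hmain : ∀ δ > 0, ∀ᶠ n in atTop, ‖h n‖ ≤ 3 * δ := by
    intro δ hδ
    set M := ‖f‖ with hM
    have hM0 : 0 ≤ M := norm_nonneg f
    -- With the crude bound 2(M + 1) for the other factor, this tolerance makes the product at most
    -- δ²/4.
    obtain ⟨A₀, hA₀, hA₀fin, hpred⟩ := hρ.exists_finite_isPredicted f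
      (show 0 < δ ^ 2 / (8 * (M + 1)) by positivity)
    obtain ⟨η, hη, hηA⟩ : ∃ η > 0, ∀ i ∈ A₀, η ≤ |T f i| := by
      rcases A₀.eq_empty_or_nonempty with rfl | hne
      · exact ⟨1, one_pos, fun i hi => absurd hi (notMem_empty i)⟩
      · obtain ⟨m, hm, hmin⟩ := exists_min_image A₀ (fun i => |T f i|) hA₀fin hne
        exact ⟨_, abs_pos.2 ((hactive f m).1 (hA₀ hm)), hmin⟩
    obtain ⟨A, b, hAη, hb0, hb, hAb⟩ := exists_finset_gap (T f) hη
    have hAact : (A : Set (Coord Υ)) ⊆ activeSet ρ f := fun i hi =>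
      (hactive f i).2 (abs_pos.1 (hη.trans_le ((hAη i).1 hi)))
    have hAsq : ∀ i ∈ A, η ^ 2 ≤ T f i ^ 2 := fun i hi => by
      rw [← sq_abs (T f i)]
      exact pow_le_pow_left₀ hη.le ((hAη i).1 hi) 2
    have hpredA := hpred A (fun i hi => (hAη i).2 (hηA i hi)) hAact A.finite_toSet
    set c := (hρ.labels A).card
    -- N is so large that replacing A by another set of the same cardinality loses more than the
    -- labels and the product can gain, and that root values are controlled by the weighted
    -- coordinates.
    obtain ⟨N, hN1, hN2⟩ : ∃ N : ℕ, (c : ℝ) * M ^ 2 + 4 * M ^ 2 ≤ (N : ℝ) ^ 2 * (η ^ 2 - b) ∧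
        ∀ r, Coord.root r ∈ A → 1 ≤ (N : ℝ) * α r := by
      have hev1 : ∀ᶠ N : ℕ in atTop, (c : ℝ) * M ^ 2 + 4 * M ^ 2 ≤ (N : ℝ) ^ 2 * (η ^ 2 - b) :=
        (((tendsto_pow_atTop two_ne_zero).comp tendsto_natCast_atTop_atTop).atTop_mul_const
          (sub_pos.2 hb)).eventually_ge_atTop _
      have hev2 : ∀ᶠ N : ℕ in atTop, ∀ i ∈ A, ∀ r, i = Coord.root r → 1 ≤ (N : ℝ) * α r := by
        rw [Filter.eventually_all_finset]
        rintro (r | s) -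
        · filter_upwards [(tendsto_natCast_atTop_atTop.atTop_mul_const
            (hα r)).eventually_ge_atTop 1] with N hN r' hr'
          obtain rfl := Coord.root.inj hr'
          exact hN
        · exact Eventually.of_forall fun N r hr => by cases hr
      obtain ⟨N, h1, h2⟩ := (hev1.and hev2).exists
      exact ⟨N, h1, fun r hr => h2 _ hr r rfl⟩
    set K := ∑ k ∈ hρ.labels A, (1 / 2 * (optEval k.1 f - optEval k.2 f)) ^ 2 with hK
    have hsmall : ∀ t, |(f t - optEval (lab A t).1 f) * (f t - optEval (lab A t).2 f)| ≤
        δ ^ 2 / 4 := by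
      intro t
      have hle : ∀ o : Option Υ, |f t - optEval o f| ≤ 2 * (M + 1) := fun o => by
        have h1 := abs_le.1 (abs_apply_le_norm f t)
        have h2 := abs_le.1 (abs_optEval_le o f)
        exact abs_le.2 ⟨by linarith, by linarith⟩
      have heq : δ ^ 2 / (8 * (M + 1)) * (2 * (M + 1)) = δ ^ 2 / 4 := by field_simp; ring
      rw [abs_mul, ← heq]
      rcases hpredA t with h | h
      · exact mul_le_mul h.le (hle _) (abs_nonneg _) (by positivity)
      · rw [mul_comm]
        exact mul_le_mul h.le (hle _) (abs_nonneg _) (by positivity)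
    set S := (N : ℝ) ^ 2 * ∑ i ∈ A, T f i ^ 2
    have hK0 : 0 ≤ K := Finset.sum_nonneg fun _ _ => sq_nonneg _
    -- For A itself the sum at f is within δ²/4 of S + K for every t, and no competitor exceeds S +
    -- K + δ²/4. This gives q(h)² ≤ δ²/4 + δ²/4 + δ²/2 = δ², uniformly in t.
    have hev := hkey f h hlim (A.card, N, c) (S + K + δ ^ 2 / 4) (by
      rintro ⟨⟨A', t⟩, hcard, hlc⟩
      simp only at hcard hlc
      rw [sumSqSeminorm_sq, sum_testFunctional_sq T _ _ (hlab _ _)]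
      by_cases hA' : A' = A
      · subst hA'
        have := (abs_le.1 (hsmall t)).2
        simp only
        linarith
      · have h1 := sum_sq_add_le_of_ne hb.le hAsq hAb hcard hA'
        have h2 : ∑ k ∈ hρ.labels A', (1 / 2 * (optEval k.1 f - optEval k.2 f)) ^ 2 ≤
            c * M ^ 2 := by
          have : ∀ k ∈ hρ.labels A', (1 / 2 * (optEval k.1 f - optEval k.2 f)) ^ 2 ≤ M ^ 2 := by
            intro k _
            have h1 := abs_le.1 (abs_optEval_le k.1 f)
            have h2 := abs_le.1 (abs_optEval_le k.2 f)
            exact sq_le_sq' (by linarith) (by linarith)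
          refine (Finset.sum_le_card_nsmul _ _ _ this).trans ?_
          rw [nsmul_eq_mul]
          exact mul_le_mul_of_nonneg_right (by exact_mod_cast hlc) (sq_nonneg _)
        have h3 : (f t - optEval (lab A' t).1 f) * (f t - optEval (lab A' t).2 f) ≤ 4 * M ^ 2 := by
          have hle : ∀ o : Option Υ, |f t - optEval o f| ≤ 2 * M := fun o => by
            have h1 := abs_le.1 (abs_apply_le_norm f t)
            have h2 := abs_le.1 (abs_optEval_le o f)
            exact abs_le.2 ⟨by linarith, by linarith⟩
          refine (le_abs_self _).trans ?_
          rw [abs_mul]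
          refine (mul_le_mul (hle _) (hle _) (abs_nonneg _) (by positivity)).trans (le_of_eq ?_)
          ring
        have h4 := mul_le_mul_of_nonneg_left h1 (sq_nonneg (N : ℝ))
        rw [mul_add] at h4
        have h5 : 0 ≤ δ ^ 2 / 4 := by positivity
        simp only
        linarith) (δ ^ 2 / 2) (by positivity)
    filter_upwards [hev] with n hn
    have hq : ∀ t, ∑ k, testFunctional T N A (hρ.labels A) (lab A t) t k (h n) ^ 2 ≤ δ ^ 2 := by
      intro t
      have h1 := hn ⟨(A, t), rfl, le_rfl⟩
      rw [sumSqSeminorm_sq, sumSqSeminorm_sq, sum_testFunctional_sq T _ _ (hlab _ _) t f] at h1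
      have h2 := (abs_le.1 (hsmall t)).1
      simp only at h1
      linarith
    have hterm : ∀ t k, |testFunctional T N A (hρ.labels A) (lab A t) t k (h n)| ≤ δ :=
      fun t k => abs_le_of_sq_le_sq ((Finset.single_le_sum
        (f := fun k => testFunctional T N A (hρ.labels A) (lab A t) t k (h n) ^ 2)
        (fun _ _ => sq_nonneg _) (Finset.mem_univ k)).trans (hq t)) hδ.le
    have hmid : ∀ t, |h n t - 1 / 2 * (optEval (lab A t).1 (h n) + optEval (lab A t).2 (h n))| ≤
        δ := fun t => by
      simpa [testFunctional, mul_add] using hterm t (.inr ⟨lab A t, hlab A t⟩)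
    have hroot : ∀ t, |optEval (lab A t).2 (h n)| ≤ δ := by
      intro t
      rcases ho : (lab A t).2 with _ | r
      · simpa using hδ.le
      · have hr : Coord.root r ∈ A := (of_maxPt_eq_some ho).1.1
        have h1 := hterm t (.inl ⟨_, hr⟩)
        have hr' : IsRoot ρ r := (hAact hr).1
        simp only [testFunctional, _root_.smul_apply, ContinuousLinearMap.comp_apply,
          evalCLM_apply, smul_eq_mul, hTr, if_pos hr', ← mul_assoc, abs_mul] at h1
        rw [optEval_some]
        rw [← abs_mul, abs_of_pos (one_pos.trans_le (hN2 r hr))] at h1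
        nlinarith [hN2 r hr, abs_nonneg (h n r)]
    have hhead : ∀ t, |optEval (lab A t).1 (h n)| ≤ 3 * δ := by
      intro t
      rcases ho : (lab A t).1 with _ | m
      · rw [optEval_none, abs_zero]; positivity
      -- Since m is its own head, the midpoint estimate at m bounds half of h(m) by δ plus half a
      -- root value, whence 3δ.
      · have hm : (lab A m).1 = some m := headPt_headPt ho
        have h1 := abs_le.1 (hmid m)
        have h2 := abs_le.1 (hroot m)
        rw [hm, optEval_some] at h1
        rw [optEval_some]
        exact abs_le.2 ⟨by linarith, by linarith⟩
    refine norm_le_of_forall_abs_le (by positivity) fun t => ?_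
    have h1 := abs_le.1 (hmid t)
    have h2 := abs_le.1 (hroot t)
    have h3 := abs_le.1 (hhead t)
    exact abs_le.2 ⟨by linarith, by linarith⟩
  obtain ⟨c, C, hc, hC, hpC⟩ := hp
  have hnorm : Tendsto (fun n => ‖h n‖) atTop (𝓝 0) := by
    rw [Metric.tendsto_nhds]
    intro ε hε
    filter_upwards [hmain (ε / 6) (by positivity)] with n hn
    rw [dist_zero_right, norm_norm]
    linarith
  refine squeeze_zero (fun n => apply_nonneg p _) (fun n => (hpC (h n)).2) ?_
  simpa using hnorm.const_mul C

/-- A function in the kernel has no active coordinate, because the weights at roots and good points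
are positive. -/
theorem IsRegularPotential.exists_injective {ρ : Υ → ℝ} (hρ : IsRegularPotential ρ) :
    ∃ T : C₀(Υ, ℝ) →L[ℝ] C₀(Coord Υ, ℝ), Function.Injective T := by
  obtain ⟨T, α, β, hα, hβ, hTr, hTs⟩ := exists_coord_operator (Υ := Υ) hρ.mono
  refine ⟨T, (injective_iff_map_eq_zero T).2 fun f hf => hρ.eq_zero ?_⟩
  refine eq_empty_of_forall_notMem ?_
  rintro (r | s) hi
  · have h1 := hTr f r
    rw [if_pos hi.1, hf, ZeroAtInftyContinuousMap.zero_apply] at h1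
    exact mul_ne_zero (hα r).ne' hi.2 h1.symm
  · have h1 := hTs f s
    rw [if_pos hi.1, hf, ZeroAtInftyContinuousMap.zero_apply] at h1
    exact mul_ne_zero (hβ s).ne' hi.2 h1.symm

end Conclusion

end TreeRenorming

/-- For a discrete space `I`, the Banach space `C₀(I, ℝ)` is `c₀(I)`. -/
theorem theorem5p1 (Υ : Type u) [PartialOrder Υ] [TopologicalSpace Υ]
    [TreeRenorming.IsHausdorffTree Υ] [TreeRenorming.IsTreeTopology Υ] :
    List.TFAE
      [ ∃ p : Seminorm ℝ C₀(Υ, ℝ),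
          TreeRenorming.IsEquivalentNorm p ∧ TreeRenorming.IsStrictlyConvexNorm p,
        ∃ p : Seminorm ℝ C₀(Υ, ℝ),
          TreeRenorming.IsEquivalentNorm p ∧ TreeRenorming.IsMLURNorm p,
        ∃ ρ : Υ → ℝ, Monotone ρ ∧
          (∀ Γ : Set Υ, Γ.Nonempty → TreeRenorming.IsEverBranching Γ →
            ¬ ∃ c : ℝ, ∀ t ∈ Γ, ρ t = c) ∧
          (∀ s : Υ, {u : Υ | TreeRenorming.IsBadPoint ρ u ∧ s ≤ u ∧ ρ u = ρ s}.Subsingleton),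
        ∃ (I : Type u) (_ : TopologicalSpace I) (_ : DiscreteTopology I)
          (T : C₀(Υ, ℝ) →L[ℝ] C₀(I, ℝ)), Function.Injective T ] := by
  tfae_have 1 → 3 := by
    rintro ⟨p, hp, hsc⟩
    exact ⟨TreeRenorming.headInf p, TreeRenorming.headInf_mono p,
      fun Γ hne hΓ => TreeRenorming.headInf_not_const_of_isEverBranching hp hsc hne hΓ,
      TreeRenorming.subsingleton_isBadPoint_headInf hp hsc⟩
  tfae_have 3 → 2 := by
    rintro ⟨ρ, hρ, hΓ, hbad⟩
    exact (TreeRenorming.isRegularPotential_leftLimit hρ hΓ hbad).exists_mlurNorm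
  tfae_have 2 → 1 := by
    rintro ⟨p, hp, h⟩
    exact ⟨p, hp, h.isStrictlyConvexNorm hp⟩
  tfae_have 3 → 4 := by
    rintro ⟨ρ, hρ, hΓ, hbad⟩
    obtain ⟨T, hT⟩ := (TreeRenorming.isRegularPotential_leftLimit hρ hΓ hbad).exists_injective
    exact ⟨TreeRenorming.Coord Υ, inferInstance, inferInstance, T, hT⟩
  tfae_have 4 → 1 := by
    rintro ⟨I, _, _, T, hT⟩
    exact TreeRenorming.exists_strictlyConvexNorm_of_injective T hT
  tfae_finish
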